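/- Let $p$ be an odd prime, $K=\mathbb F_{p^2}$, and let $i\in K$ with $i^2=-1$. Let $T_0=K(x_0)$ be the rational function field and, for $j\ge 0$, $T_{j+1}=T_j(x_{j+1})$ with $x_{j+1}^2=\dfrac{x_j^2+1}{2x_j}$. For each $j\ge 0$, each of the places $x_0=\infty,\,0,\,i,\,-i$ of $T_0$ has exactly one place of $T_j$ above it, denoted $P_\infty^j,P_0^j,P_i^j,P_{-i}^j$ respectively, and there is exactly one place $P_{-1}^j$ of $T_j$ with $x_j(P_{-1}^j)=-1$. Put $D_{-2}^j=P_0^j$, $D_{-1}^j=P_i^j+P_{-i}^j$ and, for $0\le r\le j$, let $D_r^j$ be the sum of the (finitely many) places of $T_j$ lying over $P_{-1}^r$. Then the principal divisors of $x_j$ and $1+x_j$ in $T_j$ are as follows: $$(x_0)=-P_\infty^0+P_0^0,\qquad (x_1)=-P_\infty^1-P_0^1+D_{-1}^1,$$ $$(1+x_0)=-P_\infty^0+P_{-1}^0,\qquad (1+x_1)=-P_\infty^1-P_0^1+2P_{-1}^1,$$ and for all $j\ge 2$ $$(x_j)=-P_\infty^j-\sum_{r=-2}^{\lfloor (j-3)/2\rfloor}D_r^j-\sum_{r=\lfloor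 (j-1)/2\rfloor}^{j-3}2^{2r-j+2}D_r^j+2^{j-2}D_{j-2}^j,$$ $$(1+x_j)=-P_\infty^j-\sum_{r=-2}^{\lfloor (j-3)/2\rfloor}D_r^j-\sum_{r=\lfloor (j-1)/2\rfloor}^{j-3}2^{2r-j+2}D_r^j+2^{j}P_{-1}^j.$$ In particular, for every $j\ge 0$ the function $1+x_j$ has the single zero $P_{-1}^j$, of order $2^j$. -/

import Mathlib

noncomputable section

/-- A place of `L / K`, given by its valuation ring `O`: a ring `K ⊊ O ⊊ L` such that
`z ∈ O` or `z⁻¹ ∈ O` for every `z` in `L`. -/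
structure Place (K L : Type*) [Field K] [Field L] [Algebra K L] where
  /-- the valuation ring of the place -/
  ring : ValuationSubring L
  const_lt : (algebraMap K L).range < ring.toSubring
  ne_top : ring ≠ ⊤

namespace Place

variable {K L M : Type*} [Field K] [Field L] [Algebra K L] [Field M] [Algebra K M]

/-- `z(P) = a`: the function `z - a` lies in the maximal ideal of the valuation ring of `P`. -/
def HasValue (P : Place K L) (z : L) (a : K) : Prop :=
  z - algebraMap K L a ∈ P.ring.nonunits

/-- `z(P) = ∞`. -/
def IsPole (P : Place K L) (z : L) : Prop :=
  z ∉ P.ring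

/-- `v_P(z) = n` for the normalized discrete valuation of `P`: one has `z = t ^ n * u` with a
generator `t` of the maximal ideal and a unit `u` of the valuation ring. -/
def HasOrder (P : Place K L) (z : L) (n : ℤ) : Prop :=
  ∃ t : P.ring, IsLocalRing.maximalIdeal P.ring = Ideal.span {t} ∧
    ∃ u : P.ringˣ, z = (t : L) ^ n * ((u : P.ring) : L)

/-- `Q ∣ P`: the place `Q` of `M` lies over the place `P` of `L`, where `f` embeds `L` in `M`. -/
def LiesOver (f : L →ₐ[K] M) (Q : Place K M) (P : Place K L) : Prop :=
  Q.ring.comap (f : L →+* M) = P.ring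

end Place

/-- The group of divisors of `L / K`: the free abelian group on the places. -/
abbrev PlaceDivisor (K L : Type*) [Field K] [Field L] [Algebra K L] := Place K L →₀ ℤ

namespace PlaceDivisor

variable {K L : Type*} [Field K] [Field L] [Algebra K L]

/-- The sum of the places in a (finite) set of places, each with multiplicity one. -/
def sumOf (S : Set (Place K L)) : PlaceDivisor K L :=
  ∑ᶠ Q ∈ S, Finsupp.single Q 1

/-- `D` is the principal divisor `(z)`, i.e. `v_P(z) = D(P)` for every place `P`. -/
def IsDivisorOf (D : PlaceDivisor K L) (z : L) : Prop :=
  ∀ P : Place K L, P.HasOrder z (D P)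

end PlaceDivisor

namespace FunctionTower

variable {K F : Type*} [Field K] [Field F] [Algebra K F]

/-- The recursive relations of the tower: `x 0` is transcendental over `K` and
`x (j + 1) ^ 2 = (x j ^ 2 + 1) / (2 * x j)`. -/
def IsGenerating (K : Type*) {F : Type*} [Field K] [Field F] [Algebra K F] (x : ℕ → F) : Prop :=
  Transcendental K (x 0) ∧ ∀ j, x (j + 1) ^ 2 = (x j ^ 2 + 1) / (2 * x j)

/-- Generating sequences exist over every field `K`. -/
theorem exists_isGenerating (K : Type*) [Field K] :
    ∃ x : ℕ → AlgebraicClosure (RatFunc K), IsGenerating K x := by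
  have hs : ∀ y : AlgebraicClosure (RatFunc K), ∃ z, z ^ 2 = (y ^ 2 + 1) / (2 * y) :=
    fun y => IsAlgClosed.exists_pow_nat_eq _ two_pos
  choose s hs using hs
  refine ⟨fun n => Nat.rec (algebraMap (RatFunc K) _ RatFunc.X) (fun _ y => s y) n, ?_,
    fun j => hs _⟩
  exact (transcendental_algebraMap_iff (algebraMap (RatFunc K) _).injective).2
    RatFunc.transcendental_X

/-- The function field `T_j = K(x 0, …, x j)`. -/
def level (K : Type*) {F : Type*} [Field K] [Field F] [Algebra K F] (x : ℕ → F) (j : ℕ) :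
    IntermediateField K F :=
  IntermediateField.adjoin K (x '' Set.Iic j)

theorem level_mono (x : ℕ → F) {r j : ℕ} (h : r ≤ j) : level K x r ≤ level K x j :=
  IntermediateField.adjoin.mono K _ _ (Set.image_mono (Set.Iic_subset_Iic.2 h))

/-- The function `x j` as an element of `T_j`. -/
def gen (K : Type*) {F : Type*} [Field K] [Field F] [Algebra K F] (x : ℕ → F) (j : ℕ) :
    level K x j :=
  ⟨x j, IntermediateField.subset_adjoin K _ ⟨j, Set.mem_Iic.2 le_rfl, rfl⟩⟩

/-- The places of `T_j` that lie over some place of `T_r` in the set `S`. -/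
def placesAbove (x : ℕ → F) {r j : ℕ} (h : r ≤ j) (S : Set (Place K (level K x r))) :
    Set (Place K (level K x j)) :=
  {Q | ∃ P ∈ S, Place.LiesOver (IntermediateField.inclusion (level_mono x h)) Q P}

/-- The places of `T_j` over the pole of `x 0` in `T_0`; the only one is `P_∞^j`. -/
def placesInf (K : Type*) {F : Type*} [Field K] [Field F] [Algebra K F] (x : ℕ → F) (j : ℕ) :
    Set (Place K (level K x j)) :=
  placesAbove x (Nat.zero_le j) {P | P.IsPole (gen K x 0)}

/-- The places of `T_j` over the place of `T_0` with `x 0 = a`; for `a = 0, i, -i` the only one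
is `P_a^j`. -/
def placesAt (x : ℕ → F) (j : ℕ) (a : K) : Set (Place K (level K x j)) :=
  placesAbove x (Nat.zero_le j) {P | P.HasValue (gen K x 0) a}

/-- The places of `T_j` with `x j = -1`; the only one is `P_{-1}^j`. -/
def placesNegOne (K : Type*) {F : Type*} [Field K] [Field F] [Algebra K F] (x : ℕ → F) (j : ℕ) :
    Set (Place K (level K x j)) :=
  {P | P.HasValue (gen K x j) (-1)}

/-- The divisor `P_∞^j`. -/
def divInf (K : Type*) {F : Type*} [Field K] [Field F] [Algebra K F] (x : ℕ → F) (j : ℕ) :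
    PlaceDivisor K (level K x j) :=
  PlaceDivisor.sumOf (placesInf K x j)

/-- The divisor `P_a^j` for `a = 0, i, -i`. -/
def divAt (x : ℕ → F) (j : ℕ) (a : K) : PlaceDivisor K (level K x j) :=
  PlaceDivisor.sumOf (placesAt x j a)

/-- The divisor `P_{-1}^j`. -/
def divNegOne (K : Type*) {F : Type*} [Field K] [Field F] [Algebra K F] (x : ℕ → F) (j : ℕ) :
    PlaceDivisor K (level K x j) :=
  PlaceDivisor.sumOf (placesNegOne K x j)

/-- The divisors `D_r^j` for `-2 ≤ r ≤ j` (zero for other `r`): `D_{-2}^j = P_0^j`,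
`D_{-1}^j = P_i^j + P_{-i}^j`, and for `r ≥ 0` the sum of the places of `T_j` over `P_{-1}^r`. -/
def divD (x : ℕ → F) (i : K) (j : ℕ) (r : ℤ) : PlaceDivisor K (level K x j) :=
  if r = -2 then divAt x j (0 : K)
  else if r = -1 then divAt x j i + divAt x j (-i)
  else if h : 0 ≤ r ∧ r.toNat ≤ j then
    PlaceDivisor.sumOf (placesAbove x h.2 (placesNegOne K x r.toNat))
  else 0

/-- The divisor
`P_∞^j + ∑_{r=-2}^{⌊(j-3)/2⌋} D_r^j + ∑_{r=⌊(j-1)/2⌋}^{j-3} 2^{2r-j+2} D_r^j` for `j ≥ 2`.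
Integer division by `2` is the floor, and the exponents are nonnegative in the given range. -/
def poleDivisor (x : ℕ → F) (i : K) (j : ℕ) : PlaceDivisor K (level K x j) :=
  divInf K x j
    + ∑ r ∈ Finset.Icc (-2 : ℤ) (((j : ℤ) - 3) / 2), divD x i j r
    + ∑ r ∈ Finset.Icc (((j : ℤ) - 1) / 2) ((j : ℤ) - 3),
        (2 : ℤ) ^ (2 * r - (j : ℤ) + 2).toNat • divD x i j r

end FunctionTower

end

/-! Each `T_{j+1}` arises from `T_j` by adjoining a square root `x_{j+1}` of `f = (x_j ^ 2 + 1) / (2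
* x_j)`, and 2 is invertible because `K` has odd order. At a place where `f` has odd order there is
at most one place above, orders double, and the root has the order of `f`; where `f` has even order
the extension is unramified and the root has half that order (`hasOrd_of_odd`, `eq_of_odd`,
`hasOrd_of_even`).

If `x_j` has a zero or pole of order `n`, then `f` has a pole of order `n`. So `x_{j+1}` has a pole,
of order `n / 2` for even `n` and `n` for odd `n`: a power of 2 is halved at each step until it is
1, and then stays 1 through ramification (`hasOrd_gen_succ_of_pow`). A zero of `x_{j+1}` forces `x_j
^ 2 = -1`; then either `j = 0` and `x_0 = ±i`, or `x_{j-1} = -1`, because `x_j ^ 2 + 1 = (x_{j-1} +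
1) ^ 2 / (2 * x_{j-1})`. Hence all zeros and poles lie over `x_0 ∈ {∞, 0, i, -i}` or over some `x_r
= -1` (`place_cases`), and these types exclude one another (`OfIndex.unique`).

Where `x_r = -1`, all earlier `x_k` equal 1, and `x_{k+1} ^ 2 - 1 = (x_k - 1) ^ 2 / (2 * x_k)`
doubles the order at each step, so `1 + x_r` has order `2 ^ r` (`hasOrd_gen_sub`). Then `x_{r+1} ^ 2
+ 1` has order `2 ^ (r+1)`, `x_{r+2}` has a zero of order `2 ^ r`, and `x_{r+3+m}` a pole of order
`2 ^ (r-1-m)`, with the exponent cut off at 0. For `j = r+3+m` the exponent is `2r-j+2`, which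
explains the two ranges in the pole divisor.

Over `x_0 = ∞, 0, ±i` every radicand has odd order, so the place above is unique; a place with `x_j
= ±1` is singled out by the residue of `x_j`. -/

namespace ValuationSubring

/-! ### Orders with respect to a discrete valuation ring. -/

variable {L M : Type*} [Field L] [Field M]

/-- `t` is a uniformizer of the discrete valuation ring `A`. -/
def IsUniformizer (A : ValuationSubring L) (t : L) : Prop :=
  t ≠ 0 ∧ A.valuation t < 1 ∧ ∀ z, z ≠ 0 → ∃ n : ℤ, A.valuation z = A.valuation t ^ n

/-- `z` has order `n` with respect to the discrete valuation ring `A`. -/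
def HasOrd (A : ValuationSubring L) (z : L) (n : ℤ) : Prop :=
  ∃ t, A.IsUniformizer t ∧ A.valuation z = A.valuation t ^ n

variable {A : ValuationSubring L}

theorem IsUniformizer.pos {t : L} (ht : A.IsUniformizer t) : 0 < A.valuation t :=
  A.valuation.pos_iff.2 ht.1

/-- Each value is an integral power of the other, so the exponents multiply to 1; both values are
below 1, so the exponents are positive. This makes orders independent of the uniformizer. -/
theorem IsUniformizer.valuation_eq {s t : L} (hs : A.IsUniformizer s) (ht : A.IsUniformizer t) :
    A.valuation s = A.valuation t := by
  obtain ⟨n, hn⟩ := hs.2.2 t ht.1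
  obtain ⟨m, hm⟩ := ht.2.2 s hs.1
  have h : A.valuation s ^ (n * m) = A.valuation s ^ (1 : ℤ) := by
    rw [zpow_mul, ← hn, ← hm, zpow_one]
  rw [zpow_right_inj₀ hs.pos hs.2.1.ne] at h
  have hn0 : 0 < n := by
    have := ht.2.1
    rw [hn] at this
    by_contra hle
    exact absurd this (not_lt.2 (by
      have := zpow_le_zpow_right_of_le_one₀ hs.pos hs.2.1.le (not_lt.1 hle)
      simpa using this))
  have : n = 1 := Int.eq_one_of_mul_eq_one_right hn0.le h
  rw [hn, this, zpow_one]

theorem hasOrd_iff {t z : L} {n : ℤ} (ht : A.IsUniformizer t) :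
    A.HasOrd z n ↔ A.valuation z = A.valuation t ^ n :=
  ⟨fun ⟨_, hs, h⟩ => by rw [h, hs.valuation_eq ht], fun h => ⟨t, ht, h⟩⟩

theorem HasOrd.exists_isUniformizer {z : L} {n : ℤ} (h : A.HasOrd z n) :
    ∃ t, A.IsUniformizer t :=
  let ⟨t, ht, _⟩ := h
  ⟨t, ht⟩

theorem IsUniformizer.hasOrd {t : L} (ht : A.IsUniformizer t) : A.HasOrd t 1 :=
  ⟨t, ht, by simp⟩

theorem IsUniformizer.exists_hasOrd {t z : L} (ht : A.IsUniformizer t) (hz : z ≠ 0) :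
    ∃ n, A.HasOrd z n :=
  let ⟨n, hn⟩ := ht.2.2 z hz
  ⟨n, t, ht, hn⟩

theorem HasOrd.congr {w z : L} {n : ℤ} (h : A.HasOrd z n) (hw : A.valuation w = A.valuation z) :
    A.HasOrd w n :=
  let ⟨t, ht, h⟩ := h
  ⟨t, ht, hw.trans h⟩

theorem HasOrd.isUniformizer {z : L} (h : A.HasOrd z 1) : A.IsUniformizer z := by
  obtain ⟨t, ht, h⟩ := h
  rw [zpow_one] at h
  refine ⟨fun h0 => ht.1 ?_, h ▸ ht.2.1, by simpa only [h] using ht.2.2⟩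
  rw [h0, map_zero] at h
  exact A.valuation.zero_iff.1 h.symm

theorem HasOrd.mul {w z : L} {m n : ℤ} (hw : A.HasOrd w m) (hz : A.HasOrd z n) :
    A.HasOrd (w * z) (m + n) := by
  obtain ⟨t, ht, h⟩ := hw
  rw [hasOrd_iff ht] at *
  rw [map_mul, h, hz, zpow_add₀ ht.pos.ne']

theorem HasOrd.inv {z : L} {n : ℤ} (hz : A.HasOrd z n) : A.HasOrd z⁻¹ (-n) := by
  obtain ⟨t, ht, h⟩ := hz
  exact ⟨t, ht, by rw [map_inv₀, h, zpow_neg]⟩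

theorem HasOrd.div {w z : L} {m n : ℤ} (hw : A.HasOrd w m) (hz : A.HasOrd z n) :
    A.HasOrd (w / z) (m - n) := by
  rw [div_eq_mul_inv, sub_eq_add_neg]
  exact hw.mul hz.inv

theorem HasOrd.zpow {z : L} {n : ℤ} (hz : A.HasOrd z n) (k : ℤ) : A.HasOrd (z ^ k) (n * k) := by
  obtain ⟨t, ht, h⟩ := hz
  exact ⟨t, ht, by rw [map_zpow₀, h, zpow_mul]⟩

theorem HasOrd.pow {z : L} {n : ℤ} (hz : A.HasOrd z n) (k : ℕ) : A.HasOrd (z ^ k) (n * k) := by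
  simpa using hz.zpow k

theorem HasOrd.unique {z : L} {m n : ℤ} (hm : A.HasOrd z m) (hn : A.HasOrd z n) : m = n := by
  obtain ⟨t, ht, h⟩ := hm
  rw [hasOrd_iff ht, h] at hn
  exact (zpow_right_inj₀ ht.pos ht.2.1.ne).1 hn

theorem HasOrd.valuation_lt_one_iff {z : L} {n : ℤ} (h : A.HasOrd z n) :
    A.valuation z < 1 ↔ 0 < n := by
  obtain ⟨t, ht, h⟩ := h
  rw [h, ← zpow_zero (A.valuation t), zpow_lt_zpow_iff_right_of_lt_one₀ ht.pos ht.2.1]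

theorem HasOrd.one_lt_valuation_iff {z : L} {n : ℤ} (h : A.HasOrd z n) :
    1 < A.valuation z ↔ n < 0 := by
  obtain ⟨t, ht, h⟩ := h
  rw [h, ← zpow_zero (A.valuation t), zpow_lt_zpow_iff_right_of_lt_one₀ ht.pos ht.2.1]

theorem IsUniformizer.hasOrd_zero {t z : L} (ht : A.IsUniformizer t) (h : A.valuation z = 1) :
    A.HasOrd z 0 :=
  ⟨t, ht, by rw [h, zpow_zero]⟩

theorem HasOrd.valuation_eq_one {z : L} (h : A.HasOrd z 0) : A.valuation z = 1 := by
  obtain ⟨t, _, h⟩ := h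
  rw [h, zpow_zero]

theorem HasOrd.of_sq {z : L} {n : ℤ} (h : A.HasOrd (z ^ 2) (2 * n)) : A.HasOrd z n := by
  obtain ⟨t, ht, h⟩ := h
  refine ⟨t, ht, ?_⟩
  rw [map_pow, mul_comm, zpow_mul, ← zpow_natCast] at h
  exact (zpow_left_inj₀ zero_le zero_le (by norm_num)).1 h

theorem HasOrd.mul_unit {w z : L} {m : ℤ} (hw : A.HasOrd w m) (hz : A.valuation z = 1) :
    A.HasOrd (w * z) m :=
  hw.congr (by rw [map_mul, hz, mul_one])

/-- If the valuations of two elements `a` and `b` are at most `1` and not both below, then one of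
`a + b * y`, `a - b * y` is a unit for every unit `y`. -/
theorem valuation_add_or_sub_eq_one {a b y : L} (h2 : A.valuation 2 = 1) (hy : A.valuation y = 1)
    (ha : A.valuation a ≤ 1) (hb : A.valuation b ≤ 1)
    (hab : ¬(A.valuation a < 1 ∧ A.valuation b < 1)) :
    A.valuation (a + b * y) = 1 ∨ A.valuation (a - b * y) = 1 := by
  have hby : A.valuation (b * y) = A.valuation b := by rw [map_mul, hy, mul_one]
  have h₁ : A.valuation (a + b * y) ≤ 1 := A.valuation.map_add_le ha (hby.trans_le hb)
  have h₂ : A.valuation (a - b * y) ≤ 1 := A.valuation.map_sub_le ha (hby.trans_le hb)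
  by_contra! h
  have h₁ := lt_of_le_of_ne h₁ h.1
  have h₂ := lt_of_le_of_ne h₂ h.2
  refine hab ⟨?_, ?_⟩
  · have := A.valuation.map_add_lt h₁ h₂
    rwa [show a + b * y + (a - b * y) = 2 * a by ring, map_mul, h2, one_mul] at this
  · have := A.valuation.map_sub_lt h₁ h₂
    rwa [show a + b * y - (a - b * y) = 2 * (b * y) by ring, map_mul, h2, one_mul, hby] at this

theorem eq_of_forall_valuation_le_one {A B : ValuationSubring L}
    (h : ∀ z, A.valuation z ≤ 1 ↔ B.valuation z ≤ 1) : A = B := by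
  ext z
  rw [← A.valuation_le_one_iff, h, B.valuation_le_one_iff]

/-! ### Comparison of orders along a field embedding. -/

section comap

variable {φ : L →+* M} {B : ValuationSubring M}

theorem valuation_map_le_one_iff (hB : B.comap φ = A) {a : L} :
    B.valuation (φ a) ≤ 1 ↔ A.valuation a ≤ 1 := by
  rw [valuation_le_one_iff, valuation_le_one_iff, ← hB, mem_comap]

theorem valuation_map_lt_one_iff (hB : B.comap φ = A) {a : L} :
    B.valuation (φ a) < 1 ↔ A.valuation a < 1 := by
  rcases eq_or_ne a 0 with rfl | ha
  · simp
  rw [← not_le, ← not_le, Valuation.one_le_val_iff _ ha,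
    Valuation.one_le_val_iff _ ((map_ne_zero φ).2 ha), ← map_inv₀, valuation_map_le_one_iff hB]

theorem valuation_map_eq_one_iff (hB : B.comap φ = A) {a : L} :
    B.valuation (φ a) = 1 ↔ A.valuation a = 1 := by
  rw [eq_iff_le_not_lt, eq_iff_le_not_lt, valuation_map_le_one_iff hB, valuation_map_lt_one_iff hB]

/-- The two value groups are different types, and only comparisons with 1 pass directly between the
rings; the quotient `a / b` reduces to these. -/
theorem valuation_map_eq_iff (hB : B.comap φ = A) {a b : L} :
    B.valuation (φ a) = B.valuation (φ b) ↔ A.valuation a = A.valuation b := by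
  rcases eq_or_ne b 0 with rfl | hb
  · simp
  have h₁ := A.valuation.ne_zero_iff.2 hb
  have h₂ := B.valuation.ne_zero_iff.2 ((map_ne_zero φ).2 hb)
  rw [← div_eq_one_iff_eq h₁, ← div_eq_one_iff_eq h₂, ← map_div₀, ← map_div₀, ← map_div₀,
    valuation_map_eq_one_iff hB]

/-- Here `e` is the ramification index. -/
theorem HasOrd.map (hB : B.comap φ = A) {t z : L} {e n : ℤ} (ht : A.IsUniformizer t)
    (hz : A.HasOrd z n) (h : B.HasOrd (φ t) e) : B.HasOrd (φ z) (e * n) := by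
  rw [hasOrd_iff ht, ← map_zpow₀, ← valuation_map_eq_iff hB, map_zpow₀] at hz
  exact (h.zpow n).congr hz

end comap

/-! ### Ramification when a square root is adjoined. -/

/-- `M` is spanned by `1` and `y` over the image of `L`, and `y` is a square root of `f`. -/
structure IsSqrtExtension (φ : L →+* M) (y : M) (f : L) : Prop where
  sq : y ^ 2 = φ f
  span : ∀ z, ∃ a b, z = φ a + φ b * y

namespace IsSqrtExtension

variable {φ : L →+* M} {y : M} {f : L} {B B₁ B₂ : ValuationSubring M}

theorem scale (h : IsSqrtExtension φ y f) {c : L} (hc : c ≠ 0) :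
    IsSqrtExtension φ (φ c * y) (c ^ 2 * f) where
  sq := by rw [mul_pow, h.sq, map_mul, map_pow]
  span z := by
    obtain ⟨a, b, rfl⟩ := h.span z
    have := (map_ne_zero φ).2 hc
    exact ⟨a, b * c⁻¹, by rw [map_mul, map_inv₀]; field_simp⟩

/-- Factor out the coefficient of larger valuation. -/
theorem exists_normalized (h : IsSqrtExtension φ y f) (A : ValuationSubring L) {z : M}
    (hz : z ≠ 0) : ∃ s a b, z = φ s * (φ a + φ b * y) ∧ A.valuation a ≤ 1 ∧ A.valuation b ≤ 1 ∧
      ¬(A.valuation a < 1 ∧ A.valuation b < 1) := by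
  obtain ⟨a, b, rfl⟩ := h.span z
  rcases le_total (A.valuation a) (A.valuation b) with hab | hab
  · have hb : b ≠ 0 := by
      rintro rfl
      rw [map_zero, le_zero_iff, Valuation.zero_iff] at hab
      simp [hab] at hz
    refine ⟨b, a / b, 1, ?_, ?_, by simp, by simp⟩
    · have := (map_ne_zero φ).2 hb
      rw [map_div₀, map_one]
      field_simp
    · rw [map_div₀]
      exact div_le_one_of_le₀ hab zero_le
  · have ha : a ≠ 0 := by
      rintro rfl
      rw [map_zero, le_zero_iff, Valuation.zero_iff] at hab
      simp [hab] at hz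
    refine ⟨a, 1, b / a, ?_, by simp, ?_, by simp⟩
    · have := (map_ne_zero φ).2 ha
      rw [map_div₀, map_one]
      field_simp
    · rw [map_div₀]
      exact div_le_one_of_le₀ hab zero_le

theorem valuation_eq_one (h : IsSqrtExtension φ y f) (hB : B.comap φ = A)
    (hf : A.valuation f = 1) : B.valuation y = 1 := by
  have : B.valuation y ^ 2 = 1 := by
    rw [← map_pow, h.sq, valuation_map_eq_one_iff hB, hf]
  exact (pow_eq_one_iff_of_nonneg zero_le two_ne_zero).1 this

theorem valuation_two (hB : B.comap φ = A) (h2 : A.valuation 2 = 1) : B.valuation 2 = 1 := by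
  rwa [← valuation_map_eq_one_iff hB, map_ofNat] at h2

/-- Multiplication by the unit conjugate turns the element into its norm, which comes from `L`. -/
theorem valuation_conj (h : IsSqrtExtension φ y f) {s a b : L}
    (hab : B.valuation (φ a - φ b * y) = 1) :
    B.valuation (φ s * (φ a + φ b * y)) = B.valuation (φ (s * (a ^ 2 - b ^ 2 * f))) := by
  have : φ (s * (a ^ 2 - b ^ 2 * f)) = φ s * (φ a + φ b * y) * (φ a - φ b * y) := by
    simp only [map_mul, map_sub, map_pow, ← h.sq]
    ring
  rw [this, map_mul _ _ (φ a - φ b * y), hab, mul_one]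

/-- For a unit radicand the value group does not grow: a normalized element or its conjugate is a
unit. -/
theorem exists_valuation_eq (h : IsSqrtExtension φ y f) (hB : B.comap φ = A)
    (h2 : A.valuation 2 = 1) (hf : A.valuation f = 1) {z : M} (hz : z ≠ 0) :
    ∃ c, B.valuation z = B.valuation (φ c) := by
  obtain ⟨s, a, b, rfl, ha, hb, hab⟩ := h.exists_normalized A hz
  rw [← valuation_map_le_one_iff hB] at ha hb
  rw [← valuation_map_lt_one_iff hB, ← valuation_map_lt_one_iff hB] at hab
  rcases valuation_add_or_sub_eq_one (valuation_two hB h2) (h.valuation_eq_one hB hf) ha hb hab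
    with h' | h'
  · exact ⟨s, by rw [map_mul, h', mul_one]⟩
  · exact ⟨_, h.valuation_conj h'⟩

theorem isUniformizer_map_of_unit (h : IsSqrtExtension φ y f) (hB : B.comap φ = A)
    (h2 : A.valuation 2 = 1) (hf : A.valuation f = 1) {t : L} (ht : A.IsUniformizer t) :
    B.IsUniformizer (φ t) := by
  refine ⟨(map_ne_zero φ).2 ht.1, (valuation_map_lt_one_iff hB).2 ht.2.1, fun z hz => ?_⟩
  obtain ⟨c, hc⟩ := h.exists_valuation_eq hB h2 hf hz
  have hc0 : c ≠ 0 := by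
    rintro rfl
    simp [hz] at hc
  obtain ⟨n, hn⟩ := ht.2.2 c hc0
  exact ⟨n, by rw [hc, ← map_zpow₀, ← map_zpow₀, valuation_map_eq_iff hB, hn, map_zpow₀]⟩

/-- If `f` has even order, then the uniformizers of `A` are uniformizers of `B`. -/
theorem isUniformizer_map (h : IsSqrtExtension φ y f) (hB : B.comap φ = A)
    (h2 : A.valuation 2 = 1) {n : ℤ} (hf : A.HasOrd f (2 * n)) {t : L} (ht : A.IsUniformizer t) :
    B.IsUniformizer (φ t) := by
  -- Dividing `y` by `t ^ n` divides `f` by `t ^ (2 * n)` and leaves a unit radicand.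
  refine (h.scale (zpow_ne_zero (-n) ht.1)).isUniformizer_map_of_unit hB h2 ?_ ht
  have := ((ht.hasOrd.zpow (-n)).pow 2).mul hf
  rw [show 1 * -n * (2 : ℕ) + 2 * n = 0 by push_cast; ring] at this
  exact this.valuation_eq_one

theorem hasOrd_map (h : IsSqrtExtension φ y f) (hB : B.comap φ = A)
    (h2 : A.valuation 2 = 1) {n : ℤ} (hf : A.HasOrd f (2 * n)) {z : L} {m : ℤ}
    (hz : A.HasOrd z m) : B.HasOrd (φ z) m := by
  obtain ⟨t, ht⟩ := hf.exists_isUniformizer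
  simpa using hz.map hB ht (h.isUniformizer_map hB h2 hf ht).hasOrd

/-- If `f` has even order `2 * n`, then its square root has order `n`. -/
theorem hasOrd_of_even (h : IsSqrtExtension φ y f) (hB : B.comap φ = A)
    (h2 : A.valuation 2 = 1) {n : ℤ} (hf : A.HasOrd f (2 * n)) : B.HasOrd y n :=
  HasOrd.of_sq (h.sq ▸ h.hasOrd_map hB h2 hf hf)

/-- Equality would give `2 * ord a = 2 * ord b + 1` after squaring. -/
theorem valuation_ne_of_isUniformizer (h : IsSqrtExtension φ y f) (hB : B.comap φ = A)
    (hf : A.IsUniformizer f) {a b : L} (hb : b ≠ 0) :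
    B.valuation (φ a) ≠ B.valuation (φ b * y) := by
  intro hab
  have : B.valuation (φ (a ^ 2)) = B.valuation (φ (b ^ 2 * f)) := by
    rw [map_pow φ, map_pow, hab, ← map_pow, mul_pow, h.sq, map_mul φ, map_pow φ]
  rw [valuation_map_eq_iff hB] at this
  have ha : a ≠ 0 := by
    rintro rfl
    simp [hb, hf.1] at this
  obtain ⟨n, hn⟩ := hf.exists_hasOrd ha
  obtain ⟨m, hm⟩ := hf.exists_hasOrd hb
  have := (hn.pow 2).unique (((hm.pow 2).mul hf.hasOrd).congr this)
  push_cast at this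
  omega

theorem valuation_add_eq_max (h : IsSqrtExtension φ y f) (hB : B.comap φ = A)
    (hf : A.IsUniformizer f) (a b : L) :
    B.valuation (φ a + φ b * y) = max (B.valuation (φ a)) (B.valuation (φ b * y)) := by
  rcases eq_or_ne b 0 with rfl | hb
  · simp
  · exact B.valuation.map_add_of_distinct_val (h.valuation_ne_of_isUniformizer hB hf hb)

theorem isUniformizer_sqrt (h : IsSqrtExtension φ y f) (hB : B.comap φ = A)
    (hf : A.IsUniformizer f) : B.IsUniformizer y := by
  have hy0 : y ≠ 0 := by
    rintro rfl
    exact hf.1 ((map_eq_zero φ).1 (by simpa using h.sq.symm))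
  have hv : B.valuation (φ f) = B.valuation y ^ 2 := by rw [← map_pow, h.sq]
  have key : ∀ c, c ≠ 0 → ∃ n : ℤ, B.valuation (φ c) = B.valuation y ^ n := fun c hc => by
    obtain ⟨n, hn⟩ := hf.2.2 c hc
    refine ⟨2 * n, ?_⟩
    rw [← map_zpow₀, ← valuation_map_eq_iff hB, map_zpow₀, map_zpow₀, hv] at hn
    rw [hn, zpow_mul]
    rfl
  refine ⟨hy0, ?_, fun z hz => ?_⟩
  · have := (valuation_map_lt_one_iff hB).2 hf.2.1
    rw [hv] at this
    exact (pow_lt_one_iff_of_nonneg zero_le two_ne_zero).1 this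
  · obtain ⟨a, b, rfl⟩ := h.span z
    rw [h.valuation_add_eq_max hB hf]
    have hy : B.valuation y ≠ 0 := B.valuation.ne_zero_iff.2 hy0
    have hby : b ≠ 0 → ∃ n : ℤ, B.valuation (φ b * y) = B.valuation y ^ n := fun hb => by
      obtain ⟨n, hn⟩ := key b hb
      exact ⟨n + 1, by rw [map_mul, hn, zpow_add_one₀ hy]⟩
    rcases eq_or_ne a 0 with rfl | ha
    · obtain ⟨n, hn⟩ := hby (by rintro rfl; simp at hz)
      exact ⟨n, by simp [← hn]⟩
    rcases eq_or_ne b 0 with rfl | hb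
    · simpa using key a ha
    · rcases max_choice (B.valuation (φ a)) (B.valuation (φ b * y)) with hm | hm <;> rw [hm]
      exacts [key a ha, hby hb]

theorem odd_scale {n : ℤ} (hf : A.HasOrd f (2 * n + 1)) :
    ∃ c, c ≠ 0 ∧ A.HasOrd c (-n) ∧ A.IsUniformizer (c ^ 2 * f) := by
  obtain ⟨t, ht⟩ := hf.exists_isUniformizer
  have hc : A.HasOrd (t ^ (-n)) (-n) := by simpa using ht.hasOrd.zpow (-n)
  refine ⟨t ^ (-n), zpow_ne_zero _ ht.1, hc, HasOrd.isUniformizer ?_⟩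
  convert (hc.pow 2).mul hf using 1
  push_cast
  ring

/-- If `f` has odd order, then orders double. -/
theorem hasOrd_map_of_odd (h : IsSqrtExtension φ y f) (hB : B.comap φ = A)
    {n : ℤ} (hf : A.HasOrd f (2 * n + 1)) {z : L} {m : ℤ}
    (hz : A.HasOrd z m) : B.HasOrd (φ z) (2 * m) := by
  obtain ⟨c, hc0, hc, hu⟩ := odd_scale hf
  have hs := h.scale hc0
  refine hz.map hB hu ?_
  rw [← hs.sq]
  simpa using (hs.isUniformizer_sqrt hB hu).hasOrd.pow 2

theorem hasOrd_of_odd (h : IsSqrtExtension φ y f) (hB : B.comap φ = A)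
    {n : ℤ} (hf : A.HasOrd f (2 * n + 1)) : B.HasOrd y (2 * n + 1) :=
  HasOrd.of_sq (h.sq ▸ h.hasOrd_map_of_odd hB hf hf)

/-- As valuations of sums are maxima, `a + b * y` is integral exactly when `a` and `b ^ 2 * f` are,
a condition on `A` alone. -/
theorem le_of_isUniformizer (h : IsSqrtExtension φ y f) (h₁ : B₁.comap φ = A)
    (h₂ : B₂.comap φ = A) (hf : A.IsUniformizer f) : B₁ ≤ B₂ := by
  intro z hz
  obtain ⟨a, b, rfl⟩ := h.span z
  rw [← valuation_le_one_iff, h.valuation_add_eq_max h₁ hf, max_le_iff] at hz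
  rw [← valuation_le_one_iff, h.valuation_add_eq_max h₂ hf, max_le_iff,
    valuation_map_le_one_iff h₂, ← valuation_map_le_one_iff h₁]
  refine ⟨hz.1, ?_⟩
  have e : (φ b * y) ^ 2 = φ (b ^ 2 * f) := by rw [mul_pow, h.sq, map_mul, map_pow]
  have := hz.2
  rwa [← pow_le_one_iff_of_nonneg zero_le two_ne_zero, ← map_pow, e, valuation_map_le_one_iff h₁,
    ← valuation_map_le_one_iff h₂, ← e, map_pow,
    pow_le_one_iff_of_nonneg zero_le two_ne_zero] at this

/-- If `f` has odd order, then there is at most one valuation ring over `A`. -/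
theorem eq_of_odd (h : IsSqrtExtension φ y f) (h₁ : B₁.comap φ = A)
    (h₂ : B₂.comap φ = A) {n : ℤ} (hf : A.HasOrd f (2 * n + 1)) : B₁ = B₂ := by
  obtain ⟨c, hc0, -, hu⟩ := odd_scale hf
  have hs := h.scale hc0
  exact le_antisymm (hs.le_of_isUniformizer h₁ h₂ hu) (hs.le_of_isUniformizer h₂ h₁ hu)

theorem eq_of_exists_valuation_eq (h₁ : B₁.comap φ = A) (h₂ : B₂.comap φ = A)
    (H : ∀ z, z ≠ 0 → ∃ w, B₁.valuation z = B₁.valuation (φ w) ∧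
      B₂.valuation z = B₂.valuation (φ w)) : B₁ = B₂ := by
  refine eq_of_forall_valuation_le_one fun z => ?_
  rcases eq_or_ne z 0 with rfl | hz
  · simp
  obtain ⟨w, hw₁, hw₂⟩ := H z hz
  rw [hw₁, hw₂, valuation_map_le_one_iff h₁, valuation_map_le_one_iff h₂]

/-- A valuation ring over `A` is determined by the residue class of `y` if this is the class of an
element of `L`. -/
theorem eq_of_residue (h : IsSqrtExtension φ y f) (h₁ : B₁.comap φ = A)
    (h₂ : B₂.comap φ = A) (h2 : A.valuation 2 = 1) (hf : A.valuation f = 1) {c : L}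
    (hc₁ : B₁.valuation (y - φ c) < 1) (hc₂ : B₂.valuation (y - φ c) < 1) : B₁ = B₂ := by
  have hc : A.valuation c = 1 := by
    have hy := h.valuation_eq_one h₁ hf
    rw [← valuation_map_eq_one_iff h₁, ← hy]
    refine Valuation.map_eq_of_sub_lt _ ?_
    rwa [hy, Valuation.map_sub_swap]
  refine eq_of_exists_valuation_eq h₁ h₂ fun z hz => ?_
  obtain ⟨s, a, b, rfl, ha, hb, hab⟩ := h.exists_normalized A hz
  have aux : ∀ B : ValuationSubring M, B.comap φ = A → B.valuation (y - φ c) < 1 → ∀ b' : L,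
      A.valuation b' ≤ 1 → A.valuation (a + b' * c) = 1 → B.valuation (φ a + φ b' * y) = 1 := by
    intro B hB hcB b' hb' h1
    rw [← valuation_map_eq_one_iff hB] at h1
    rw [← h1]
    refine Valuation.map_eq_of_sub_lt _ ?_
    -- Modulo the maximal ideal, `y` may be replaced by `c`, so being a unit is decided in `A`.
    rw [h1, show φ a + φ b' * y - φ (a + b' * c) = φ b' * (y - φ c) by
      rw [map_add, map_mul]; ring, map_mul]
    exact mul_lt_one_of_nonneg_of_lt_one_right ((valuation_map_le_one_iff hB).2 hb') zero_le hcB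
  rcases valuation_add_or_sub_eq_one h2 hc ha hb hab with h' | h'
  · exact ⟨s, by rw [map_mul, aux B₁ h₁ hc₁ b hb h', mul_one],
      by rw [map_mul, aux B₂ h₂ hc₂ b hb h', mul_one]⟩
  · have hb' : A.valuation (-b) ≤ 1 := by rwa [Valuation.map_neg]
    have h' : A.valuation (a + -b * c) = 1 := by rwa [neg_mul, ← sub_eq_add_neg]
    have aux' : ∀ B : ValuationSubring M, B.comap φ = A → B.valuation (y - φ c) < 1 →
        B.valuation (φ a - φ b * y) = 1 := fun B hB hcB => by
      simpa [sub_eq_add_neg] using aux B hB hcB (-b) hb' h'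
    exact ⟨_, h.valuation_conj (aux' B₁ h₁ hc₁), h.valuation_conj (aux' B₂ h₂ hc₂)⟩

/-- If a normalized `a + b * y` were a nonunit, then `b` would be a unit and `y` congruent to `-a /
b`. So every such combination is a unit, and valuations are read off the scalar factor. -/
theorem eq_of_inert (h : IsSqrtExtension φ y f) (h₁ : B₁.comap φ = A)
    (h₂ : B₂.comap φ = A) (hf : A.valuation f = 1)
    (hc₁ : ∀ c, ¬B₁.valuation (y - φ c) < 1) (hc₂ : ∀ c, ¬B₂.valuation (y - φ c) < 1) :
    B₁ = B₂ := by
  refine eq_of_exists_valuation_eq h₁ h₂ fun z hz => ?_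
  obtain ⟨s, a, b, rfl, ha, hb, hab⟩ := h.exists_normalized A hz
  have aux : ∀ B : ValuationSubring M, B.comap φ = A → (∀ c, ¬B.valuation (y - φ c) < 1) →
      B.valuation (φ a + φ b * y) = 1 := by
    intro B hB hcB
    have hy := h.valuation_eq_one hB hf
    have hby : B.valuation (φ b * y) = B.valuation (φ b) := by rw [map_mul, hy, mul_one]
    have hle : B.valuation (φ a + φ b * y) ≤ 1 :=
      B.valuation.map_add_le ((valuation_map_le_one_iff hB).2 ha)
        (hby.trans_le ((valuation_map_le_one_iff hB).2 hb))
    by_contra hne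
    have hlt := lt_of_le_of_ne hle hne
    by_cases hb1 : A.valuation b < 1
    · refine hab ⟨?_, hb1⟩
      rw [← valuation_map_lt_one_iff hB] at hb1 ⊢
      rw [← hby] at hb1
      simpa using B.valuation.map_sub_lt hlt hb1
    · have hb1 : A.valuation b = 1 := le_antisymm hb (not_lt.1 hb1)
      have hb0 : φ b ≠ 0 := (map_ne_zero φ).2 (by rintro rfl; simp at hb1)
      refine hcB (-a / b) ?_
      rw [← valuation_map_eq_one_iff hB] at hb1
      rw [← one_mul (B.valuation _), ← hb1, ← map_mul]
      convert hlt using 2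
      rw [map_div₀, map_neg]
      field_simp
      ring
  exact ⟨s, by rw [map_mul, aux B₁ h₁ hc₁, mul_one], by rw [map_mul, aux B₂ h₂ hc₂, mul_one]⟩

/-- If `y` is congruent to `c` at one ring, then `(y - c) * (y + c) = f - c ^ 2` is a nonunit of
`A`, so at every ring over `A` the residue of `y` is that of `c` or `-c`. If no such `c` exists, the
inert case gives at most one ring. -/
theorem finite_of_unit (h : IsSqrtExtension φ y f) (h2 : A.valuation 2 = 1)
    (hf : A.valuation f = 1) : {B : ValuationSubring M | B.comap φ = A}.Finite := by
  by_cases H : ∃ B : ValuationSubring M, B.comap φ = A ∧ ∃ c, B.valuation (y - φ c) < 1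
  · obtain ⟨B, hB, c, hc⟩ := H
    have hS : ∀ d, {B : ValuationSubring M | B.comap φ = A ∧
        B.valuation (y - φ d) < 1}.Finite := fun d =>
      Set.Subsingleton.finite fun B₁ h₁ B₂ h₂ => h.eq_of_residue h₁.1 h₂.1 h2 hf h₁.2 h₂.2
    refine ((hS c).union (hS (-c))).subset fun B' hB' => ?_
    have hy := h.valuation_eq_one hB hf
    have hprod : (y - φ c) * (y - φ (-c)) = φ (f - c ^ 2) := by
      rw [map_neg, map_sub, ← h.sq, map_pow]
      ring
    have hlt : A.valuation (f - c ^ 2) < 1 := by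
      rw [← valuation_map_lt_one_iff hB, ← hprod, map_mul]
      refine mul_lt_one_of_nonneg_of_lt_one_left zero_le hc ?_
      rw [show y - φ (-c) = 2 * y - (y - φ c) by rw [map_neg]; ring]
      refine B.valuation.map_sub_le ?_ hc.le
      rw [map_mul, hy, valuation_two hB h2, one_mul]
    rw [← valuation_map_lt_one_iff hB', ← hprod, map_mul] at hlt
    by_contra hcon
    have h₁ : 1 ≤ B'.valuation (y - φ c) := not_lt.1 fun h => hcon (Or.inl ⟨hB', h⟩)
    have h₂ : 1 ≤ B'.valuation (y - φ (-c)) := not_lt.1 fun h => hcon (Or.inr ⟨hB', h⟩)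
    exact absurd hlt (not_lt.2 (one_le_mul_of_one_le_of_one_le h₁ h₂))
  · push Not at H
    exact Set.Subsingleton.finite fun B₁ h₁ B₂ h₂ =>
      h.eq_of_inert h₁ h₂ hf (fun c => not_lt.2 (H B₁ h₁ c)) fun c => not_lt.2 (H B₂ h₂ c)

/-- There are finitely many valuation rings over a discrete valuation ring. -/
theorem finite_setOf_comap_eq (h : IsSqrtExtension φ y f) (h2 : A.valuation 2 = 1)
    {n : ℤ} (hf : A.HasOrd f n) : {B : ValuationSubring M | B.comap φ = A}.Finite := by
  obtain ⟨t, ht⟩ := hf.exists_isUniformizer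
  rcases Int.even_or_odd' n with ⟨k, rfl | rfl⟩
  · refine (h.scale (zpow_ne_zero (-k) ht.1)).finite_of_unit h2 ?_
    have := ((ht.hasOrd.zpow (-k)).pow 2).mul hf
    rw [show 1 * -k * (2 : ℕ) + 2 * k = 0 by push_cast; ring] at this
    exact this.valuation_eq_one
  · exact Set.Subsingleton.finite fun B₁ h₁ B₂ h₂ => h.eq_of_odd h₁ h₂ hf

theorem exists_isUniformizer (h : IsSqrtExtension φ y f) (hB : B.comap φ = A)
    (h2 : A.valuation 2 = 1) {n : ℤ} (hf : A.HasOrd f n) : ∃ t, B.IsUniformizer t := by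
  obtain ⟨t, ht⟩ := hf.exists_isUniformizer
  rcases Int.even_or_odd' n with ⟨k, rfl | rfl⟩
  · exact ⟨_, h.isUniformizer_map hB h2 hf ht⟩
  · exact (h.hasOrd_of_odd hB hf).exists_isUniformizer

end IsSqrtExtension

end ValuationSubring

/-! ### Places: restriction, orders and existence. -/

namespace Place

open Polynomial

variable {K L M : Type*} [Field K] [Field L] [Algebra K L] [Field M] [Algebra K M]

theorem ext_ring {P Q : Place K L} (h : P.ring = Q.ring) : P = Q := by
  cases P
  cases Q
  congr

theorem ring_injective : Function.Injective (Place.ring : Place K L → ValuationSubring L) :=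
  fun _ _ => ext_ring

theorem algebraMap_mem (P : Place K L) (c : K) : algebraMap K L c ∈ P.ring :=
  P.const_lt.le ⟨c, rfl⟩

theorem _root_.ValuationSubring.valuation_algebraMap {A : ValuationSubring L}
    (hA : ∀ c : K, algebraMap K L c ∈ A) {c : K} (hc : c ≠ 0) :
    A.valuation (algebraMap K L c) = 1 := by
  refine le_antisymm ((A.valuation_le_one_iff _).2 (hA c)) ?_
  have := (A.valuation_le_one_iff _).2 (hA c⁻¹)
  rwa [map_inv₀, ← Valuation.one_le_val_iff _ ((_root_.map_ne_zero _).2 hc)] at this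

theorem valuation_algebraMap (P : Place K L) {c : K} (hc : c ≠ 0) :
    P.ring.valuation (algebraMap K L c) = 1 :=
  ValuationSubring.valuation_algebraMap P.algebraMap_mem hc

theorem valuation_two (P : Place K L) (h2 : (2 : K) ≠ 0) : P.ring.valuation 2 = 1 := by
  simpa only [map_ofNat] using P.valuation_algebraMap h2

theorem hasValue_iff {P : Place K L} {z : L} {a : K} :
    P.HasValue z a ↔ P.ring.valuation (z - algebraMap K L a) < 1 :=
  Iff.rfl

theorem hasValue_zero_iff {P : Place K L} {z : L} :
    P.HasValue z (0 : K) ↔ P.ring.valuation z < 1 := by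
  rw [hasValue_iff, map_zero, sub_zero]

theorem isPole_iff {P : Place K L} {z : L} : P.IsPole z ↔ 1 < P.ring.valuation z := by
  rw [IsPole, ← ValuationSubring.valuation_le_one_iff, not_le]

/-- A valuation ring over the constant field with a nonzero nonunit is a place. -/
def ofNonunit (A : ValuationSubring L) (hA : ∀ c : K, algebraMap K L c ∈ A) (z : L)
    (hz : z ≠ 0) (hz1 : A.valuation z < 1) : Place K L where
  ring := A
  const_lt := by
    refine lt_of_le_of_ne (by rintro _ ⟨c, rfl⟩; exact hA c) fun h => ?_
    have hmem : z ∈ (algebraMap K L).range := by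
      rw [h]
      exact (A.valuation_le_one_iff z).1 hz1.le
    obtain ⟨c, rfl⟩ := hmem
    exact hz1.ne (ValuationSubring.valuation_algebraMap hA ((_root_.map_ne_zero _).1 hz))
  ne_top := by
    rintro rfl
    rw [Valuation.val_lt_one_iff _ hz] at hz1
    exact absurd hz1 (not_lt.2 ((ValuationSubring.valuation_le_one_iff _ _).2 trivial))

/-- The restriction of a place `Q` of `M` to a subfield containing a nonzero nonunit of `Q`. -/
def restrict (f : L →ₐ[K] M) (Q : Place K M) (z : L) (hz : z ≠ 0)
    (hz1 : Q.ring.valuation (f z) < 1) : Place K L :=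
  ofNonunit (Q.ring.comap (f : L →+* M))
    (fun c => by
      rw [ValuationSubring.mem_comap]
      simpa using Q.algebraMap_mem c)
    z hz (by rwa [← ValuationSubring.valuation_map_lt_one_iff rfl])

theorem liesOver_restrict (f : L →ₐ[K] M) (Q : Place K M) (z : L) (hz : z ≠ 0)
    (hz1 : Q.ring.valuation (f z) < 1) : LiesOver f Q (Q.restrict f z hz hz1) :=
  rfl

theorem LiesOver.hasValue_iff {f : L →ₐ[K] M} {Q : Place K M} {P : Place K L}
    (h : LiesOver f Q P) {z : L} {a : K} : Q.HasValue (f z) a ↔ P.HasValue z a := by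
  rw [Place.hasValue_iff, Place.hasValue_iff, ← ValuationSubring.valuation_map_lt_one_iff h]
  simp

theorem LiesOver.isPole_iff {f : L →ₐ[K] M} {Q : Place K M} {P : Place K L}
    (h : LiesOver f Q P) {z : L} : Q.IsPole (f z) ↔ P.IsPole z := by
  rw [IsPole, IsPole, ← h, ValuationSubring.mem_comap]
  rfl

theorem exists_liesOver {f : L →ₐ[K] M} {y : M} {d : L}
    (h : ValuationSubring.IsSqrtExtension (f : L →+* M) y d) (Q : Place K M) :
    ∃ P, LiesOver f Q P := by
  -- If the ring contained all of `L`, it would also contain `y`, as `y ^ 2` lies in `L`, and so be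
  -- all of `M`.
  have : ∃ z : L, f z ∉ Q.ring := by
    by_contra! H
    have hy : y ∈ Q.ring := by
      have := H d
      rw [← ValuationSubring.valuation_le_one_iff] at this ⊢
      have e : f d = y ^ 2 := h.sq.symm
      rwa [e, map_pow, pow_le_one_iff_of_nonneg zero_le two_ne_zero] at this
    refine Q.ne_top (eq_top_iff.2 fun z _ => ?_)
    obtain ⟨a, b, rfl⟩ := h.span z
    exact Q.ring.add_mem _ _ (H a) (Q.ring.mul_mem _ _ (H b) hy)
  obtain ⟨z, hz⟩ := this
  have hz0 : z ≠ 0 := by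
    rintro rfl
    exact hz (by rw [map_zero]; exact Q.ring.zero_mem)
  refine ⟨Q.restrict f z⁻¹ (inv_ne_zero hz0) ?_, rfl⟩
  rw [← ValuationSubring.valuation_le_one_iff, not_le] at hz
  rwa [map_inv₀, map_inv₀, ← map_inv₀, Valuation.val_lt_one_iff _
    (inv_ne_zero ((_root_.map_ne_zero f).2 hz0)), inv_inv]

/-- A uniformizer must be assumed, since a valuation ring with principal maximal ideal need not be
discrete. Given one, generators of the maximal ideal are exactly the elements with its value. -/
theorem hasOrder_iff {P : Place K L} (hP : ∃ t, P.ring.IsUniformizer t) {z : L} {n : ℤ} :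
    P.HasOrder z n ↔ P.ring.HasOrd z n := by
  obtain ⟨s, hs⟩ := hP
  have hgen : ∀ t : P.ring, IsLocalRing.maximalIdeal P.ring = Ideal.span {t} ↔
      P.ring.valuation t = P.ring.valuation s := by
    intro t
    have hsm : s ∈ P.ring := (P.ring.valuation_le_one_iff s).1 hs.2.1.le
    constructor
    · intro h
      apply le_antisymm
      · have ht : P.ring.valuation t < 1 := by
          rw [← P.ring.valuation_lt_one_iff, h]
          exact Ideal.mem_span_singleton_self t
        rcases eq_or_ne (t : L) 0 with h0 | h0
        · rw [h0, map_zero]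
          exact zero_le
        obtain ⟨n, hn⟩ := hs.exists_hasOrd h0
        have hn0 := hn.valuation_lt_one_iff.1 ht
        rw [(ValuationSubring.hasOrd_iff hs).1 hn]
        conv_rhs => rw [← zpow_one (P.ring.valuation s)]
        exact zpow_le_zpow_right_of_le_one₀ hs.pos hs.2.1.le hn0
      · have : (⟨s, hsm⟩ : P.ring) ∈ Ideal.span {t} := by
          rw [← h, P.ring.valuation_lt_one_iff]
          exact hs.2.1
        obtain ⟨a, ha⟩ := Ideal.mem_span_singleton'.1 this
        exact (P.ring.valuation_le_iff _ _).2 ⟨a, congrArg Subtype.val ha⟩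
    · intro h
      ext w
      rw [P.ring.valuation_lt_one_iff, Ideal.mem_span_singleton']
      constructor
      · intro hw
        have : P.ring.valuation w ≤ P.ring.valuation t := by
          rcases eq_or_ne (w : L) 0 with h0 | h0
          · rw [h0, map_zero]
            exact zero_le
          obtain ⟨n, hn⟩ := hs.exists_hasOrd h0
          have hn0 := hn.valuation_lt_one_iff.1 hw
          rw [(ValuationSubring.hasOrd_iff hs).1 hn, h]
          conv_rhs => rw [← zpow_one (P.ring.valuation s)]
          exact zpow_le_zpow_right_of_le_one₀ hs.pos hs.2.1.le hn0
        obtain ⟨a, ha⟩ := (P.ring.valuation_le_iff _ _).1 this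
        exact ⟨a, Subtype.ext ha⟩
      · rintro ⟨a, rfl⟩
        rw [MulMemClass.coe_mul, map_mul, h]
        exact mul_lt_one_of_nonneg_of_lt_one_right (P.ring.valuation_le_one a) zero_le hs.2.1
  constructor
  · rintro ⟨t, ht, u, rfl⟩
    rw [hgen] at ht
    refine ⟨s, hs, ?_⟩
    rw [map_mul, map_zpow₀, ht, P.ring.valuation_unit u, mul_one]
  · intro h
    have hsm : s ∈ P.ring := (P.ring.valuation_le_one_iff s).1 hs.2.1.le
    refine ⟨⟨s, hsm⟩, (hgen _).2 rfl, ?_⟩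
    rw [ValuationSubring.hasOrd_iff hs, ← map_zpow₀] at h
    obtain ⟨u, hu⟩ := (P.ring.valuation_eq_iff _ _).1 h
    exact ⟨u, by rw [← hu]; exact mul_comm _ _⟩

/-- As `z` is transcendental, `z - a` generates a proper ideal of `K[z]`, which lies in the nonunits
of some valuation ring of `L`. No lifting of places through the tower is needed. -/
theorem exists_hasValue {z : L} (hz : Transcendental K z) (a : K) :
    ∃ P : Place K L, P.HasValue z a := by
  let R : Subring L := (aeval (R := K) z).range.toSubring
  let w : R := ⟨z - algebraMap K L a, X - C a, by simp⟩
  have hI : Ideal.span {w} ≠ ⊤ := by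
    rw [Ne, Ideal.span_singleton_eq_top]
    rintro hu
    obtain ⟨⟨_, p, rfl⟩, hp⟩ := hu.exists_right_inv
    have hp : aeval z ((X - C a) * p) = aeval z (1 : K[X]) := by
      simpa [w] using congrArg Subtype.val hp
    have := congrArg (eval a) (transcendental_iff_injective.1 hz hp)
    simp at this
  obtain ⟨B, hRB, hB⟩ := Ideal.image_subset_nonunits_valuationSubring _ hI
  have hw : z - algebraMap K L a ∈ B.nonunits :=
    hB ⟨w, Ideal.mem_span_singleton_self w, rfl⟩
  refine ⟨ofNonunit B (fun c => hRB ⟨C c, by simp⟩) _ (fun h => ?_) hw, hw⟩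
  rw [sub_eq_zero] at h
  exact hz (h ▸ isAlgebraic_algebraMap a)

theorem exists_isPole {z : L} (hz : Transcendental K z) : ∃ P : Place K L, P.IsPole z := by
  have hz' : Transcendental K z⁻¹ := fun h => hz (by simpa using h.inv)
  obtain ⟨P, hP⟩ := exists_hasValue hz' 0
  refine ⟨P, isPole_iff.2 ?_⟩
  have h0 : z ≠ 0 := by
    rintro rfl
    exact hz isAlgebraic_zero
  rw [hasValue_zero_iff] at hP
  rwa [Valuation.val_lt_one_iff _ (inv_ne_zero h0), inv_inv] at hP

/-! ### Places of a rational function field. -/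

section Rational

variable {z : L} (hz : Transcendental K z)
  (hL : ∀ w : L, ∃ r s : K[X], w = aeval z r / aeval z s)

include hz in
theorem aeval_ne_zero {p : K[X]} (hp : p ≠ 0) : aeval z p ≠ 0 := fun h =>
  hp (transcendental_iff.1 hz p h)

theorem aeval_mem {P : Place K L} (h : P.ring.valuation z ≤ 1) (p : K[X]) :
    P.ring.valuation (aeval z p) ≤ 1 := by
  rw [ValuationSubring.valuation_le_one_iff] at *
  induction p using Polynomial.induction_on' with
  | add p q hp hq => rw [map_add]; exact P.ring.add_mem _ _ hp hq
  | monomial n a =>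
    rw [aeval_monomial]
    exact P.ring.mul_mem _ _ (P.algebraMap_mem a) (pow_mem h n)

/-- The exponent is the multiplicity of `q` in `p`; the cofactor is a unit by Bézout. That it does
not depend on `P` gives uniqueness of the place. -/
theorem exists_valuation_aeval_eq_pow {q p : K[X]} (hq : Irreducible q) (hp : p ≠ 0) :
    ∃ n : ℕ, ∀ P : Place K L, P.ring.valuation z ≤ 1 → P.ring.valuation (aeval z q) < 1 →
      P.ring.valuation (aeval z p) = P.ring.valuation (aeval z q) ^ n := by
  obtain ⟨n, g, hg, rfl⟩ := WfDvdMonoid.max_power_factor hp hq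
  refine ⟨n, fun P hP hPq => ?_⟩
  obtain ⟨u, w, huw⟩ := (hq.coprime_iff_not_dvd).2 hg
  have h1 : P.ring.valuation (aeval z g) = 1 := by
    refine le_antisymm (aeval_mem hP g) (not_lt.1 fun hlt => ?_)
    have := congrArg (fun p => P.ring.valuation (aeval z p)) huw
    simp only [map_add, map_mul, map_one] at this
    refine this.not_lt (Valuation.map_add_lt _ ?_ ?_) <;> rw [map_mul]
    · exact mul_lt_one_of_nonneg_of_lt_one_right (aeval_mem hP u) zero_le hPq
    · exact mul_lt_one_of_nonneg_of_lt_one_right (aeval_mem hP w) zero_le hlt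
  rw [map_mul, map_mul, h1, mul_one, map_pow, map_pow]

include hz hL in
theorem exists_valuation_eq_zpow {q : K[X]} (hq : Irreducible q) {w : L} (hw : w ≠ 0) :
    ∃ n : ℤ, ∀ P : Place K L, P.ring.valuation z ≤ 1 → P.ring.valuation (aeval z q) < 1 →
      P.ring.valuation w = P.ring.valuation (aeval z q) ^ n := by
  obtain ⟨r, s, rfl⟩ := hL w
  obtain ⟨m, hm⟩ := exists_valuation_aeval_eq_pow (L := L) (z := z) (p := r) hq
    (by rintro rfl; simp at hw)
  obtain ⟨n, hn⟩ := exists_valuation_aeval_eq_pow (L := L) (z := z) (p := s) hq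
    (by rintro rfl; simp at hw)
  refine ⟨m - n, fun P hP hPq => ?_⟩
  have h0 := P.ring.valuation.ne_zero_iff.2 (aeval_ne_zero hz hq.ne_zero)
  rw [map_div₀, hm P hP hPq, hn P hP hPq, zpow_sub₀ h0, zpow_natCast, zpow_natCast]

/-- The leading term dominates at a pole. -/
theorem valuation_aeval_of_isPole {p : K[X]} (hp : p ≠ 0) {P : Place K L}
    (hP : 1 < P.ring.valuation z) :
    P.ring.valuation (aeval z p) = P.ring.valuation z ^ p.natDegree := by
  have h0 : P.ring.valuation z ≠ 0 := (zero_lt_one.trans hP).ne'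
  have hlead : P.ring.valuation (algebraMap K L p.leadingCoeff * z ^ p.natDegree) =
      P.ring.valuation z ^ p.natDegree := by
    rw [map_mul, P.valuation_algebraMap (leadingCoeff_ne_zero.2 hp), one_mul, map_pow]
  rw [aeval_eq_sum_range, Finset.sum_range_succ, Algebra.smul_def]
  change P.ring.valuation (_ + algebraMap K L p.leadingCoeff * _) = _
  rw [Valuation.map_add_eq_of_lt_right, hlead]
  rw [hlead]
  refine Valuation.map_sum_lt _ (pow_ne_zero _ h0) fun k hk => ?_
  rw [Algebra.smul_def, map_mul, map_pow]
  refine lt_of_le_of_lt (mul_le_of_le_one_left zero_le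
    ((P.ring.valuation_le_one_iff _).2 (P.algebraMap_mem _))) ?_
  exact pow_lt_pow_right₀ hP (Finset.mem_range.1 hk)

include hL in
theorem exists_valuation_eq_zpow_of_isPole {w : L} (hw : w ≠ 0) :
    ∃ n : ℤ, ∀ P : Place K L, 1 < P.ring.valuation z →
      P.ring.valuation w = P.ring.valuation z ^ n := by
  obtain ⟨r, s, rfl⟩ := hL w
  refine ⟨r.natDegree - s.natDegree, fun P hP => ?_⟩
  rw [map_div₀, valuation_aeval_of_isPole (by rintro rfl; simp at hw) hP,
    valuation_aeval_of_isPole (by rintro rfl; simp at hw) hP,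
    zpow_sub₀ (zero_lt_one.trans hP).ne', zpow_natCast, zpow_natCast]

include hL in
theorem isUniformizer_inv_of_isPole {P : Place K L} (hP : P.IsPole z) :
    P.ring.IsUniformizer z⁻¹ := by
  rw [isPole_iff] at hP
  have h0 : z ≠ 0 := P.ring.valuation.ne_zero_iff.1 (zero_lt_one.trans hP).ne'
  refine ⟨inv_ne_zero h0, ?_, fun w hw => ?_⟩
  · rwa [Valuation.val_lt_one_iff _ (inv_ne_zero h0), inv_inv]
  · obtain ⟨n, hn⟩ := exists_valuation_eq_zpow_of_isPole hL hw
    exact ⟨-n, by rw [hn P hP, map_inv₀, inv_zpow, zpow_neg, inv_inv]⟩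

include hz hL in
theorem isUniformizer_aeval {P : Place K L} (hP : P.ring.valuation z ≤ 1) {q : K[X]}
    (hq : Irreducible q) (hPq : P.ring.valuation (aeval z q) < 1) :
    P.ring.IsUniformizer (aeval z q) :=
  ⟨aeval_ne_zero hz hq.ne_zero, hPq, fun _ hw =>
    let ⟨n, hn⟩ := exists_valuation_eq_zpow hz hL hq hw
    ⟨n, hn P hP hPq⟩⟩

theorem HasValue.valuation_le_one {P : Place K L} {w : L} {a : K} (h : P.HasValue w a) :
    P.ring.valuation w ≤ 1 := by
  rw [← sub_add_cancel w (algebraMap K L a)]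
  exact Valuation.map_add_le _ (hasValue_iff.1 h).le
    ((P.ring.valuation_le_one_iff _).2 (P.algebraMap_mem a))

include hz hL in
theorem isUniformizer_sub_of_hasValue {P : Place K L} {a : K} (h : P.HasValue z a) :
    P.ring.IsUniformizer (z - algebraMap K L a) := by
  have := isUniformizer_aeval hz hL h.valuation_le_one (irreducible_X_sub_C a)
  simp only [map_sub, aeval_X, aeval_C] at this
  exact this h

include hz hL in
theorem eq_of_hasValue {P Q : Place K L} {a : K} (hP : P.HasValue z a) (hQ : Q.HasValue z a) :
    P = Q := by
  refine ext_ring (ValuationSubring.eq_of_forall_valuation_le_one fun w => ?_)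
  rcases eq_or_ne w 0 with rfl | hw
  · simp
  obtain ⟨n, hn⟩ := exists_valuation_eq_zpow hz hL (irreducible_X_sub_C a) hw
  simp only [map_sub, aeval_X, aeval_C] at hn
  have hp := isUniformizer_sub_of_hasValue hz hL hP
  have hq := isUniformizer_sub_of_hasValue hz hL hQ
  have h₁ : P.ring.HasOrd w n := ⟨_, hp, hn P hP.valuation_le_one hP⟩
  have h₂ : Q.ring.HasOrd w n := ⟨_, hq, hn Q hQ.valuation_le_one hQ⟩
  rw [← not_lt, ← not_lt, h₁.one_lt_valuation_iff, h₂.one_lt_valuation_iff]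

include hL in
theorem eq_of_isPole {P Q : Place K L} (hP : P.IsPole z) (hQ : Q.IsPole z) : P = Q := by
  refine ext_ring (ValuationSubring.eq_of_forall_valuation_le_one fun w => ?_)
  rcases eq_or_ne w 0 with rfl | hw
  · simp
  obtain ⟨n, hn⟩ := exists_valuation_eq_zpow_of_isPole hL hw
  have key : ∀ P : Place K L, P.IsPole z → P.ring.HasOrd w (-n) := fun P hP =>
    ⟨_, isUniformizer_inv_of_isPole hL hP, by
      rw [hn P (isPole_iff.1 hP), map_inv₀, inv_zpow, zpow_neg, inv_inv]⟩
  rw [← not_lt, ← not_lt, (key P hP).one_lt_valuation_iff, (key Q hQ).one_lt_valuation_iff]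

include hz hL in
theorem exists_isUniformizer (P : Place K L) : ∃ t, P.ring.IsUniformizer t := by
  rcases lt_or_ge 1 (P.ring.valuation z) with h | h
  · exact ⟨_, isUniformizer_inv_of_isPole hL (isPole_iff.2 h)⟩
  suffices ∃ q : K[X], Irreducible q ∧ P.ring.valuation (aeval z q) < 1 by
    obtain ⟨q, hq, hPq⟩ := this
    exact ⟨_, isUniformizer_aeval hz hL h hq hPq⟩
  -- If every irreducible polynomial were a unit, every nonzero polynomial would be one, and the
  -- ring would be the whole field.
  by_contra! H
  have H' : ∀ p : K[X], p ≠ 0 → P.ring.valuation (aeval z p) = 1 := fun p => by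
    induction p using WfDvdMonoid.induction_on_irreducible with
    | zero => exact fun h => absurd rfl h
    | unit u hu =>
      intro _
      obtain ⟨c, hc, rfl⟩ := Polynomial.isUnit_iff.1 hu
      rw [aeval_C, P.valuation_algebraMap hc.ne_zero]
    | mul a q ha hq ih =>
      intro _
      rw [map_mul, map_mul, ih ha, mul_one]
      exact le_antisymm (aeval_mem h q) (H q hq)
  refine P.ne_top (eq_top_iff.2 fun w _ => ?_)
  obtain ⟨r, s, rfl⟩ := hL w
  rw [← ValuationSubring.valuation_le_one_iff, map_div₀]
  rcases eq_or_ne s 0 with rfl | hs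
  · simp
  · rw [H' s hs, div_one]
    exact aeval_mem h r

end Rational

end Place

/-! ### The recursive relation at a place. -/

namespace Place

variable {K L M : Type*} [Field K] [Field L] [Algebra K L]

section Relation

variable {a b : L} (h2 : (2 : K) ≠ 0) (hab : b ^ 2 = (a ^ 2 + 1) / (2 * a)) (P : Place K L)

theorem valuation_add_one_of_one_lt {z : L} (h : 1 < P.ring.valuation z) :
    P.ring.valuation (z + 1) = P.ring.valuation z :=
  Valuation.map_add_eq_of_lt_left _ (by rwa [map_one])

theorem valuation_add_one_of_lt_one {z : L} (h : P.ring.valuation z < 1) :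
    P.ring.valuation (z + 1) = 1 := by
  rw [Valuation.map_add_eq_of_lt_right _ (by rwa [map_one]), map_one]

include h2 hab in
-- Compare the two sides of `2 * a * b ^ 2 = a ^ 2 + 1`: a zero of `a` makes the right side a unit
-- and the left a nonunit, and at a pole of `a` the right side has the strictly larger value.
theorem valuation_eq_one_of_valuation_le_one (ha : a ≠ 0) (hb : P.ring.valuation b ≤ 1) :
    P.ring.valuation a = 1 := by
  have key : P.ring.valuation b ^ 2 * P.ring.valuation a = P.ring.valuation (a ^ 2 + 1) := by
    have h2L : P.ring.valuation (2 : L) = 1 := P.valuation_two h2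
    have h20 : (2 : L) ≠ 0 := P.ring.valuation.ne_zero_iff.1 (by simp [h2L])
    rw [← map_pow, hab, ← map_mul, ← one_mul (P.ring.valuation _), ← h2L, ← map_mul]
    congr 1
    field_simp
  have hb2 : P.ring.valuation b ^ 2 ≤ 1 := pow_le_one₀ zero_le hb
  rcases lt_trichotomy (P.ring.valuation a) 1 with h | h | h
  · have hlt : P.ring.valuation (a ^ 2) < 1 := by
      rw [map_pow]
      exact pow_lt_one₀ zero_le h two_ne_zero
    rw [P.valuation_add_one_of_lt_one hlt] at key
    exact absurd key (mul_lt_one_of_nonneg_of_lt_one_right hb2 zero_le h).ne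
  · exact h
  · have hlt : 1 < P.ring.valuation (a ^ 2) := by
      rw [map_pow]
      exact one_lt_pow₀ h two_ne_zero
    rw [P.valuation_add_one_of_one_lt hlt, map_pow] at key
    have h₁ : P.ring.valuation b ^ 2 * P.ring.valuation a ≤ P.ring.valuation a :=
      mul_le_of_le_one_left zero_le hb2
    rw [key] at h₁
    have h₂ : P.ring.valuation a ^ 1 < P.ring.valuation a ^ 2 := pow_lt_pow_right₀ h one_lt_two
    rw [pow_one] at h₂
    exact absurd h₁ (not_le.2 h₂)

include h2 hab in
theorem valuation_ne_one_of_one_lt (hb : 1 < P.ring.valuation b) : P.ring.valuation a ≠ 1 := by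
  intro ha
  have : 1 < P.ring.valuation (b ^ 2) := by
    rw [map_pow]
    exact one_lt_pow₀ hb two_ne_zero
  rw [hab, map_div₀, map_mul, P.valuation_two h2, ha, mul_one, div_one] at this
  refine absurd this (not_lt.2 (Valuation.map_add_le _ ?_ (map_one _).le))
  rw [map_pow, ha, one_pow]

include h2 hab in
theorem valuation_sq_add_one (ha : P.ring.valuation a = 1) :
    P.ring.valuation (a ^ 2 + 1) = P.ring.valuation b ^ 2 := by
  rw [← map_pow, hab, map_div₀, map_mul, P.valuation_two h2, ha, mul_one, div_one]

include h2 hab in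
theorem valuation_sq_add_one_lt_one (ha : a ≠ 0) (hb : P.ring.valuation b < 1) :
    P.ring.valuation (a ^ 2 + 1) < 1 := by
  rw [P.valuation_sq_add_one h2 hab (P.valuation_eq_one_of_valuation_le_one h2 hab ha hb.le)]
  exact pow_lt_one₀ zero_le hb two_ne_zero

theorem two_ne_zero_of (P : Place K L) (h2 : (2 : K) ≠ 0) : (2 : L) ≠ 0 :=
  P.ring.valuation.ne_zero_iff.1 (by simp [P.valuation_two h2])

/-- `b ^ 2 - ε = (a - ε) ^ 2 / (2 * a)` for `ε = ± 1`. -/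
theorem sq_sub_eq (h2 : (2 : L) ≠ 0) (hab : b ^ 2 = (a ^ 2 + 1) / (2 * a)) (ha : a ≠ 0) {e : L}
    (he : e ^ 2 = 1) : b ^ 2 - e = (a - e) ^ 2 / (2 * a) := by
  rw [hab]
  field_simp
  linear_combination -he

theorem valuation_eq_one_of_sq_sub {e : L} (he : P.ring.valuation e = 1)
    (hb : P.ring.valuation (b ^ 2 - e) < 1) : P.ring.valuation b = 1 := by
  have : P.ring.valuation (b ^ 2) = P.ring.valuation e :=
    Valuation.map_eq_of_sub_lt _ (by rwa [he])
  rw [he, map_pow] at this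
  exact (pow_eq_one_iff_of_nonneg zero_le two_ne_zero).1 this

include h2 hab in
-- Residues propagate down the tower: `b ^ 2 = 1` forces `a = 1`, and `b ^ 2 = -1` forces `a = -1`.
theorem valuation_sub_lt_one (ha : a ≠ 0) {e : L} (he : e ^ 2 = 1)
    (hb : P.ring.valuation (b ^ 2 - e) < 1) : P.ring.valuation (a - e) < 1 := by
  have hve : P.ring.valuation e = 1 := by
    have : P.ring.valuation e ^ 2 = 1 := by rw [← map_pow, he, map_one]
    exact (pow_eq_one_iff_of_nonneg zero_le two_ne_zero).1 this
  have hvb := P.valuation_eq_one_of_sq_sub hve hb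
  have hva := P.valuation_eq_one_of_valuation_le_one h2 hab ha hvb.le
  rw [sq_sub_eq (P.two_ne_zero_of h2) hab ha he, map_div₀, map_mul, P.valuation_two h2, hva,
    mul_one, div_one, map_pow] at hb
  exact (pow_lt_one_iff_of_nonneg zero_le two_ne_zero).1 hb

end Relation

theorem HasValue.unique {P : Place K L} {z : L} {a b : K} (ha : P.HasValue z a)
    (hb : P.HasValue z b) : a = b := by
  by_contra hne
  have := Valuation.map_sub_lt _ (hasValue_iff.1 hb) (hasValue_iff.1 ha)
  rw [sub_sub_sub_cancel_left, ← map_sub, P.valuation_algebraMap (sub_ne_zero.2 hne)] at this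
  exact lt_irrefl _ this

theorem HasValue.sq {P : Place K L} {z : L} {a : K} (ha : P.HasValue z a) :
    P.HasValue (z ^ 2) (a ^ 2) := by
  rw [hasValue_iff, map_pow, sq_sub_sq, map_mul]
  refine mul_lt_one_of_nonneg_of_lt_one_right (Valuation.map_add_le _ ha.valuation_le_one ?_)
    zero_le ha
  exact (P.ring.valuation_le_one_iff _).2 (P.algebraMap_mem _)

theorem HasValue.of_sq {P : Place K L} {z : L} {a : K} (ha : P.HasValue (z ^ 2) (a ^ 2)) :
    P.HasValue z a ∨ P.HasValue z (-a) := by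
  rw [hasValue_iff, map_pow, sq_sub_sq, map_mul] at ha
  by_contra! h
  simp only [hasValue_iff, not_lt, map_neg, sub_neg_eq_add] at h
  exact absurd ha (not_lt.2 (one_le_mul_of_one_le_of_one_le h.2 h.1))

theorem HasValue.valuation_eq_one {P : Place K L} {z : L} {a : K} (ha : P.HasValue z a)
    (h0 : a ≠ 0) : P.ring.valuation z = 1 := by
  have := P.valuation_algebraMap h0
  rw [← this]
  exact Valuation.map_eq_of_sub_lt _ (by rw [this]; exact ha)

end Place

/-! ### The tower as a chain of square root extensions. -/

namespace FunctionTower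

open Place ValuationSubring

variable {K F : Type*} [Field K] [Field F] [Algebra K F] {x : ℕ → F}

theorem IsGenerating.transcendental (hx : IsGenerating K x) (h2 : (2 : K) ≠ 0) (j : ℕ) :
    Transcendental K (x j) := by
  induction j with
  | zero => exact hx.1
  | succ j ih =>
    intro h
    have h0 : x j ≠ 0 := fun h => ih (h ▸ isAlgebraic_zero)
    have h2F : (2 : F) ≠ 0 := by
      rw [← map_ofNat (algebraMap K F)]
      exact (map_ne_zero _).2 h2
    have hrel := hx.2 j
    -- Completing the square in the quadratic equation of `x j` over `K(x (j + 1))` shows that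
    -- algebraicity would descend.
    have hsq : (x j - x (j + 1) ^ 2) ^ 2 = x (j + 1) ^ 4 - 1 := by
      have : x (j + 1) ^ 2 * (2 * x j) = x j ^ 2 + 1 := by
        rw [hrel]
        field_simp
      linear_combination -this
    have h₁ : IsAlgebraic K ((x j - x (j + 1) ^ 2) ^ 2) := hsq ▸ (h.pow 4).sub isAlgebraic_one
    have h₂ := (h₁.of_pow two_pos).add (h.pow 2)
    rw [sub_add_cancel] at h₂
    exact ih h₂

/-- The function `x k` as an element of `T_j` for `k ≤ j`. -/
def elt (K : Type*) {F : Type*} [Field K] [Field F] [Algebra K F] (x : ℕ → F) {k j : ℕ}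
    (h : k ≤ j) : level K x j :=
  IntermediateField.inclusion (level_mono x h) (gen K x k)

theorem transcendental_elt (hx : IsGenerating K x) (h2 : (2 : K) ≠ 0) {k j : ℕ} (h : k ≤ j) :
    Transcendental K (elt K x h) := fun ha =>
  hx.transcendental h2 k (ha.algHom (level K x j).val)

theorem elt_ne_zero (hx : IsGenerating K x) (h2 : (2 : K) ≠ 0) {k j : ℕ} (h : k ≤ j) :
    elt K x h ≠ 0 := fun h0 =>
  transcendental_elt hx h2 h (h0 ▸ isAlgebraic_zero)

theorem elt_sub_ne_zero (hx : IsGenerating K x) (h2 : (2 : K) ≠ 0) {k j : ℕ} (h : k ≤ j) (a : K) :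
    elt K x h - algebraMap K _ a ≠ 0 := fun h0 =>
  transcendental_elt hx h2 h (by rw [sub_eq_zero.1 h0]; exact isAlgebraic_algebraMap a)

theorem elt_sq (hx : IsGenerating K x) {k j : ℕ} (h : k + 1 ≤ j) :
    elt K x h ^ 2 = (elt K x (Nat.le_of_succ_le h) ^ 2 + 1) / (2 * elt K x (Nat.le_of_succ_le h)) :=
  Subtype.ext (hx.2 k)

/-- The inclusion of `T_j` in `T_{j+1}`. -/
abbrev step (K : Type*) {F : Type*} [Field K] [Field F] [Algebra K F] (x : ℕ → F) (j : ℕ) :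
    level K x j →ₐ[K] level K x (j + 1) :=
  IntermediateField.inclusion (level_mono x j.le_succ)

theorem exists_eq_add_mul_of_mem_level (hx : IsGenerating K x) (h2 : (2 : K) ≠ 0) {j : ℕ} {z : F}
    (hz : z ∈ level K x (j + 1)) :
    ∃ a ∈ level K x j, ∃ b ∈ level K x j, z = a + b * x (j + 1) := by
  have h2F : (2 : F) ≠ 0 := by
    rw [← map_ofNat (algebraMap K F)]
    exact (map_ne_zero _).2 h2
  have h2mem : (2 : F) ∈ level K x j := by
    simp
  have hgen : x j ∈ level K x j := (gen K x j).2
  have hf : x (j + 1) ^ 2 ∈ level K x j := by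
    rw [hx.2 j]
    exact div_mem (add_mem (pow_mem hgen 2) (one_mem _)) (mul_mem h2mem hgen)
  refine IntermediateField.adjoin_induction K (p := fun z _ => ∃ a ∈ level K x j,
    ∃ b ∈ level K x j, z = a + b * x (j + 1)) ?_ ?_ ?_ ?_ ?_ hz
  · rintro _ ⟨k, hk, rfl⟩
    rcases Nat.le_succ_iff.1 (Set.mem_Iic.1 hk) with hk | rfl
    · exact ⟨x k, level_mono x hk (gen K x k).2, 0, zero_mem _, by simp⟩
    · exact ⟨0, zero_mem _, 1, one_mem _, by simp⟩
  · intro c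
    exact ⟨_, (level K x j).algebraMap_mem c, 0, zero_mem _, by simp⟩
  · rintro _ _ _ _ ⟨a, ha, b, hb, rfl⟩ ⟨c, hc, d, hd, rfl⟩
    exact ⟨a + c, add_mem ha hc, b + d, add_mem hb hd, by ring⟩
  · rintro _ _ ⟨a, ha, b, hb, rfl⟩
    -- The norm may vanish, since `x (j + 1) ∉ T_j` has not been shown; in that case the element is
    -- `2 * a`.
    by_cases h0 : a - b * x (j + 1) = 0
    · refine ⟨(2 * a)⁻¹, inv_mem (mul_mem h2mem ha), 0, zero_mem _, ?_⟩
      rw [← sub_eq_zero.1 h0]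
      ring
    · have hN : a ^ 2 - b ^ 2 * x (j + 1) ^ 2 ∈ level K x j :=
        sub_mem (pow_mem ha 2) (mul_mem (pow_mem hb 2) hf)
      refine ⟨a / (a ^ 2 - b ^ 2 * x (j + 1) ^ 2), div_mem ha hN,
        -b / (a ^ 2 - b ^ 2 * x (j + 1) ^ 2), div_mem (neg_mem hb) hN, ?_⟩
      rw [show a ^ 2 - b ^ 2 * x (j + 1) ^ 2 = (a + b * x (j + 1)) * (a - b * x (j + 1)) by ring]
      rw [show a / ((a + b * x (j + 1)) * (a - b * x (j + 1))) +
        -b / ((a + b * x (j + 1)) * (a - b * x (j + 1))) * x (j + 1) =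
        (a - b * x (j + 1)) / ((a + b * x (j + 1)) * (a - b * x (j + 1))) by ring,
        div_mul_cancel_right₀ h0]
  · rintro _ _ _ _ ⟨a, ha, b, hb, rfl⟩ ⟨c, hc, d, hd, rfl⟩
    exact ⟨a * c + b * d * x (j + 1) ^ 2, add_mem (mul_mem ha hc) (mul_mem (mul_mem hb hd) hf),
      a * d + b * c, add_mem (mul_mem ha hd) (mul_mem hb hc), by ring⟩

theorem isSqrtExtension_step (hx : IsGenerating K x) (h2 : (2 : K) ≠ 0) (j : ℕ) :
    IsSqrtExtension (step K x j : level K x j →+* level K x (j + 1)) (gen K x (j + 1))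
      ((gen K x j ^ 2 + 1) / (2 * gen K x j)) where
  sq := Subtype.ext (hx.2 j)
  span z := by
    obtain ⟨a, ha, b, hb, h⟩ := exists_eq_add_mul_of_mem_level hx h2 z.2
    exact ⟨⟨a, ha⟩, ⟨b, hb⟩, Subtype.ext h⟩

theorem exists_aeval_div (z : level K x 0) :
    ∃ r s : Polynomial K, z = Polynomial.aeval (gen K x 0) r / Polynomial.aeval (gen K x 0) s := by
  have hz : (z : F) ∈ IntermediateField.adjoin K {x 0} := by
    have h0 : x '' Set.Iic 0 = {x 0} := by
      rw [show Set.Iic 0 = {0} by ext; simp, Set.image_singleton]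
    exact h0 ▸ z.2
  obtain ⟨r, s, h⟩ := (IntermediateField.mem_adjoin_simple_iff K _).1 hz
  refine ⟨r, s, Subtype.ext (h.trans ?_)⟩
  have : ∀ p : Polynomial K, Polynomial.aeval (x 0) p =
      ((Polynomial.aeval (gen K x 0) p : level K x 0) : F) := fun p =>
    Polynomial.aeval_algHom_apply (level K x 0).val (gen K x 0) p
  rw [this, this]
  rfl

theorem exists_liesOver_step (hx : IsGenerating K x) (h2 : (2 : K) ≠ 0) {j : ℕ}
    (Q : Place K (level K x (j + 1))) : ∃ P, LiesOver (step K x j) Q P :=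
  exists_liesOver (isSqrtExtension_step hx h2 j) Q

theorem exists_isUniformizer (hx : IsGenerating K x) (h2 : (2 : K) ≠ 0) {j : ℕ}
    (P : Place K (level K x j)) : ∃ t, P.ring.IsUniformizer t := by
  induction j with
  | zero => exact Place.exists_isUniformizer (transcendental_elt hx h2 le_rfl) exists_aeval_div P
  | succ j ih =>
    obtain ⟨P', hP'⟩ := exists_liesOver_step hx h2 P
    obtain ⟨t, ht⟩ := ih P'
    have hs := isSqrtExtension_step hx h2 j
    have h0 : (gen K x j ^ 2 + 1) / (2 * gen K x j) ≠ 0 := by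
      intro h
      have := hs.sq
      rw [h, map_zero, sq_eq_zero_iff] at this
      exact elt_ne_zero hx h2 le_rfl this
    obtain ⟨n, hn⟩ := ht.exists_hasOrd h0
    exact hs.exists_isUniformizer hP' (P'.valuation_two h2) hn

/-! ### Classification of the places by the residues of the generators. -/

section Places

variable (hx : IsGenerating K x) (h2 : (2 : K) ≠ 0)

include hx h2 in
theorem mem_placesAt {j : ℕ} {a : K} {Q : Place K (level K x j)} :
    Q ∈ placesAt x j a ↔ Q.HasValue (elt K x j.zero_le) a := by
  constructor
  · rintro ⟨P, hP, hQ⟩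
    exact hQ.hasValue_iff.2 hP
  · intro h
    have h' : Q.ring.valuation (IntermediateField.inclusion (level_mono x j.zero_le)
        (gen K x 0 - algebraMap K _ a)) < 1 := h
    have := liesOver_restrict _ Q _ (elt_sub_ne_zero hx h2 le_rfl a) h'
    exact ⟨_, this.hasValue_iff.1 h, this⟩

include hx h2 in
theorem mem_placesInf {j : ℕ} {Q : Place K (level K x j)} :
    Q ∈ placesInf K x j ↔ Q.IsPole (elt K x j.zero_le) := by
  constructor
  · rintro ⟨P, hP, hQ⟩
    exact hQ.isPole_iff.2 hP
  · intro h
    have h' : Q.ring.valuation (IntermediateField.inclusion (level_mono x j.zero_le)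
        (gen K x 0)⁻¹) < 1 := by
      rw [isPole_iff] at h
      rw [map_inv₀]
      change Q.ring.valuation (elt K x j.zero_le)⁻¹ < 1
      rwa [Valuation.val_lt_one_iff _ (inv_ne_zero (elt_ne_zero hx h2 _)), inv_inv]
    have := liesOver_restrict _ Q _ (inv_ne_zero (elt_ne_zero hx h2 le_rfl)) h'
    exact ⟨_, this.isPole_iff.1 h, this⟩

include hx h2 in
theorem mem_placesAbove_placesNegOne {r j : ℕ} (h : r ≤ j) {Q : Place K (level K x j)} :
    Q ∈ placesAbove x h (placesNegOne K x r) ↔ Q.HasValue (elt K x h) (-1) := by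
  constructor
  · rintro ⟨P, hP, hQ⟩
    exact hQ.hasValue_iff.2 hP
  · intro h1
    have h' : Q.ring.valuation (IntermediateField.inclusion (level_mono x h)
        (gen K x r - algebraMap K _ (-1))) < 1 := h1
    have := liesOver_restrict _ Q _ (elt_sub_ne_zero hx h2 le_rfl (-1)) h'
    exact ⟨_, this.hasValue_iff.1 h1, this⟩

/-- The type of a place: it lies over the pole of `x 0`, over a place with `x 0 ∈ {0, i, -i}`,
over a place with `x r = -1`, or `x j` and `1 + x j` are units. -/
theorem place_cases (hx : IsGenerating K x) (h2 : (2 : K) ≠ 0) {i : K} (hi : i ^ 2 = -1) {j : ℕ}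
    (P : Place K (level K x j)) :
    P.IsPole (elt K x j.zero_le) ∨ P.HasValue (elt K x j.zero_le) (0 : K) ∨
      (P.HasValue (elt K x j.zero_le) i ∨ P.HasValue (elt K x j.zero_le) (-i)) ∨
      (∃ r, ∃ h : r ≤ j, P.HasValue (elt K x h) (-1)) ∨
      (P.ring.valuation (gen K x j) = 1 ∧ P.ring.valuation (1 + gen K x j) = 1) := by
  -- Descent from a nonunit `x_k`: a pole of `x_{k+1}` makes `x_k` a nonunit, while a zero gives
  -- `x_k ^ 2 = -1`, hence `x_0 = ±i` or `x_{k-1} = -1`.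
  have key : ∀ k, ∀ h : k ≤ j, P.ring.valuation (elt K x h) ≠ 1 →
      P.IsPole (elt K x j.zero_le) ∨ P.HasValue (elt K x j.zero_le) (0 : K) ∨
      (P.HasValue (elt K x j.zero_le) i ∨ P.HasValue (elt K x j.zero_le) (-i)) ∨
      ∃ r, ∃ h : r ≤ j, P.HasValue (elt K x h) (-1) := by
    intro k
    induction k with
    | zero =>
      intro h hne
      rcases lt_or_gt_of_ne hne with hlt | hgt
      · exact Or.inr (Or.inl (hasValue_zero_iff.2 hlt))
      · exact Or.inl (isPole_iff.2 hgt)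
    | succ k ih =>
      intro h hne
      rcases lt_or_gt_of_ne hne with hlt | hgt
      · have hlt := P.valuation_sq_add_one_lt_one h2 (elt_sq hx h) (elt_ne_zero hx h2 _) hlt
        rcases k with _ | k
        · refine Or.inr (Or.inr (Or.inl (HasValue.of_sq ?_)))
          rw [hi, hasValue_iff, map_neg, map_one, sub_neg_eq_add]
          exact hlt
        · refine Or.inr (Or.inr (Or.inr ⟨k, by omega, ?_⟩))
          rw [hasValue_iff, map_neg, map_one]
          refine P.valuation_sub_lt_one h2 (elt_sq hx (Nat.le_of_succ_le h))
            (elt_ne_zero hx h2 _) (by norm_num) ?_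
          rwa [sub_neg_eq_add]
      · exact ih _ (P.valuation_ne_one_of_one_lt h2 (elt_sq hx h) hgt)
  by_cases h₁ : P.ring.valuation (gen K x j) = 1
  · by_cases h₂ : P.ring.valuation (1 + gen K x j) = 1
    · exact Or.inr (Or.inr (Or.inr (Or.inr ⟨h₁, h₂⟩)))
    · refine Or.inr (Or.inr (Or.inr (Or.inl ⟨j, le_rfl, ?_⟩)))
      rw [hasValue_iff, map_neg, map_one, sub_neg_eq_add, add_comm]
      exact lt_of_le_of_ne (Valuation.map_add_le _ (map_one _).le h₁.le) h₂
  · rcases key j le_rfl h₁ with h | h | h | h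
    exacts [Or.inl h, Or.inr (Or.inl h), Or.inr (Or.inr (Or.inl h)),
      Or.inr (Or.inr (Or.inr (Or.inl h)))]

include hx h2 in
theorem hasValue_one_of_succ {k j : ℕ} (h : k + 1 ≤ j) {P : Place K (level K x j)} {e : K}
    (he : e ^ 2 = 1) (hP : P.HasValue (elt K x h) e) :
    P.HasValue (elt K x (Nat.le_of_succ_le h)) 1 := by
  rw [hasValue_iff, map_one]
  refine P.valuation_sub_lt_one h2 (elt_sq hx h) (elt_ne_zero hx h2 _) (one_pow 2) ?_
  have := hP.sq
  rwa [he, hasValue_iff, map_one] at this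

include hx h2 in
theorem hasValue_one_of_lt {k r j : ℕ} (h : r ≤ j) (hk : k < r) {P : Place K (level K x j)} {e : K}
    (he : e ^ 2 = 1) (hP : P.HasValue (elt K x h) e) :
    P.HasValue (elt K x (hk.le.trans h)) 1 := by
  induction r generalizing e with
  | zero => omega
  | succ r ih =>
    have h1 := hasValue_one_of_succ hx h2 h he hP
    rcases Nat.lt_succ_iff_lt_or_eq.1 hk with hk | rfl
    · exact ih _ hk (one_pow 2) h1
    · exact h1

end Places

end FunctionTower

namespace FunctionTower

open Place ValuationSubring

variable {K F : Type*} [Field K] [Field F] [Algebra K F] {x : ℕ → F}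

/-! ### Orders of the generators at each type of place. -/

section Orders

variable (hx : IsGenerating K x) (h2 : (2 : K) ≠ 0) {j : ℕ}
  {P : Place K (level K x j)} {Q : Place K (level K x (j + 1))}

/-- If `x j` has order `± n` with `n` positive, then the radicand of the next step has
order `-n`. -/
theorem hasOrd_radicand (h2 : (2 : K) ≠ 0) {n : ℤ} (hn : 0 < n)
    (h : P.ring.HasOrd (gen K x j) n ∨ P.ring.HasOrd (gen K x j) (-n)) :
    P.ring.HasOrd ((gen K x j ^ 2 + 1) / (2 * gen K x j)) (-n) := by
  have h20 := P.two_ne_zero_of h2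
  obtain ⟨t, ht⟩ : ∃ t, P.ring.IsUniformizer t :=
    h.elim HasOrd.exists_isUniformizer HasOrd.exists_isUniformizer
  have hd : ∀ m, P.ring.HasOrd (gen K x j) m → P.ring.HasOrd (2 * gen K x j) m := fun m hm => by
    simpa using (ht.hasOrd_zero (P.valuation_two h2)).mul hm
  rcases h with h | h
  · have hlt : P.ring.valuation (gen K x j ^ 2) < 1 := by
      rw [map_pow]
      exact pow_lt_one₀ zero_le (h.valuation_lt_one_iff.2 hn) two_ne_zero
    simpa using (ht.hasOrd_zero (P.valuation_add_one_of_lt_one hlt)).div (hd _ h)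
  · have hlt : 1 < P.ring.valuation (gen K x j ^ 2) := by
      rw [map_pow]
      exact one_lt_pow₀ (h.one_lt_valuation_iff.2 (by omega)) two_ne_zero
    convert ((h.pow 2).congr (P.valuation_add_one_of_one_lt hlt)).div (hd _ h) using 1
    push_cast
    ring

theorem hasOrd_radicand_of_unit (h2 : (2 : K) ≠ 0) {m : ℤ}
    (ha : P.ring.valuation (gen K x j) = 1) (h : P.ring.HasOrd (gen K x j ^ 2 + 1) m) :
    P.ring.HasOrd ((gen K x j ^ 2 + 1) / (2 * gen K x j)) m := by
  obtain ⟨t, ht⟩ := h.exists_isUniformizer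
  simpa using h.div ((ht.hasOrd_zero (P.valuation_two h2)).mul (ht.hasOrd_zero ha))

include hx h2 in
-- The truncated `s - 1` covers both cases: for `s = 0` the step ramifies and the order stays `-1`;
-- for positive `s` it is unramified and the pole order is halved.
theorem hasOrd_gen_succ_of_pow (hQ : LiesOver (step K x j) Q P) {s : ℕ}
    (h : P.ring.HasOrd (gen K x j) (2 ^ s) ∨ P.ring.HasOrd (gen K x j) (-2 ^ s)) :
    Q.ring.HasOrd (gen K x (j + 1)) (-2 ^ (s - 1)) := by
  have hr := hasOrd_radicand h2 (by positivity) h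
  have hs := isSqrtExtension_step hx h2 j
  rcases s with _ | s
  · exact hs.hasOrd_of_odd hQ (n := -1) (by simpa using hr)
  · refine hs.hasOrd_of_even hQ (P.valuation_two h2) ?_
    convert hr using 1
    simp [pow_succ, mul_comm]

include hx h2 in
theorem hasOrd_gen_of_isPole (h : P.IsPole (elt K x j.zero_le)) :
    P.ring.HasOrd (gen K x j) (-1) := by
  induction j with
  | zero =>
    simpa using (isUniformizer_inv_of_isPole exists_aeval_div h).hasOrd.inv
  | succ j ih =>
    obtain ⟨P', hP'⟩ := exists_liesOver_step hx h2 P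
    have := ih (hP'.isPole_iff.1 h)
    simpa using hasOrd_gen_succ_of_pow hx h2 hP' (s := 0) (Or.inr (by simpa using this))

include hx in
theorem hasOrd_gen_zero_sub (h2 : (2 : K) ≠ 0) {P : Place K (level K x 0)} {a : K}
    (h : P.HasValue (gen K x 0) a) :
    P.ring.HasOrd (gen K x 0 - algebraMap K _ a) 1 :=
  (isUniformizer_sub_of_hasValue (transcendental_elt hx h2 le_rfl) exists_aeval_div h).hasOrd

include hx in
theorem hasOrd_gen_zero (h2 : (2 : K) ≠ 0) {P : Place K (level K x 0)}
    (h : P.HasValue (gen K x 0) (0 : K)) : P.ring.HasOrd (gen K x 0) 1 := by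
  simpa using hasOrd_gen_zero_sub hx h2 h

include hx h2 in
theorem hasOrd_gen_of_hasValue_zero {P : Place K (level K x (j + 1))}
    (h : P.HasValue (elt K x (j + 1).zero_le) (0 : K)) :
    P.ring.HasOrd (gen K x (j + 1)) (-1) := by
  induction j with
  | zero =>
    obtain ⟨P', hP'⟩ := exists_liesOver_step hx h2 P
    have := hasOrd_gen_zero hx h2 (hP'.hasValue_iff.1 h)
    simpa using hasOrd_gen_succ_of_pow hx h2 hP' (s := 0) (Or.inl (by simpa using this))
  | succ j ih =>
    obtain ⟨P', hP'⟩ := exists_liesOver_step hx h2 P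
    have := ih (hP'.hasValue_iff.1 h)
    simpa using hasOrd_gen_succ_of_pow hx h2 hP' (s := 0) (Or.inr (by simpa using this))

theorem valuation_add_of_hasValue (h2 : (2 : K) ≠ 0) {e : K} (he : e ≠ 0)
    (h : P.HasValue (gen K x j) e) :
    P.ring.valuation (gen K x j + algebraMap K _ e) = 1 := by
  rw [← P.valuation_algebraMap (mul_ne_zero h2 he)]
  refine Valuation.map_eq_of_sub_lt _ ?_
  rw [P.valuation_algebraMap (mul_ne_zero h2 he)]
  convert hasValue_iff.1 h using 2
  rw [map_mul, map_ofNat]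
  ring

section SqrtNegOne

variable {c : K} (hc : c ^ 2 = -1)

include hx h2 hc in
theorem hasOrd_gen_zero_sq_add_one {P : Place K (level K x 0)} (h : P.HasValue (gen K x 0) c) :
    P.ring.HasOrd (gen K x 0 ^ 2 + 1) 1 := by
  have h1 := hasOrd_gen_zero_sub hx h2 h
  have hc0 : c ≠ 0 := by
    rintro rfl
    simp at hc
  convert h1.mul_unit (valuation_add_of_hasValue h2 hc0 h) using 1
  have : algebraMap K (level K x 0) c ^ 2 = -1 := by rw [← map_pow, hc, map_neg, map_one]
  linear_combination this

include hx h2 hc in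
theorem hasOrd_radicand_zero {P : Place K (level K x 0)} (h : P.HasValue (gen K x 0) c) :
    P.ring.HasOrd ((gen K x 0 ^ 2 + 1) / (2 * gen K x 0)) 1 := by
  refine hasOrd_radicand_of_unit h2 (h.valuation_eq_one ?_)
    (hasOrd_gen_zero_sq_add_one hx h2 hc h)
  rintro rfl
  simp at hc

include hx h2 hc in
theorem hasOrd_gen_one {P : Place K (level K x 1)} (h : P.HasValue (elt K x zero_le_one) c) :
    P.ring.HasOrd (gen K x 1) 1 := by
  obtain ⟨P', hP'⟩ := exists_liesOver_step hx h2 P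
  have := hasOrd_radicand_zero hx h2 hc (hP'.hasValue_iff.1 h)
  exact (isSqrtExtension_step hx h2 0).hasOrd_of_odd hP' (n := 0) (by simpa using this)

include hx h2 hc in
theorem hasOrd_gen_of_sq_eq_neg_one {P : Place K (level K x (j + 2))}
    (h : P.HasValue (elt K x (j + 2).zero_le) c) :
    P.ring.HasOrd (gen K x (j + 2)) (-1) := by
  induction j with
  | zero =>
    obtain ⟨P', hP'⟩ := exists_liesOver_step hx h2 P
    have := hasOrd_gen_one hx h2 hc (hP'.hasValue_iff.1 h)
    simpa using hasOrd_gen_succ_of_pow hx h2 hP' (s := 0) (Or.inl (by simpa using this))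
  | succ j ih =>
    obtain ⟨P', hP'⟩ := exists_liesOver_step hx h2 P
    have := ih (hP'.hasValue_iff.1 h)
    simpa using hasOrd_gen_succ_of_pow hx h2 hP' (s := 0) (Or.inr (by simpa using this))

end SqrtNegOne

theorem hasOrd_radicand_of_hasValue (h2 : (2 : K) ≠ 0) {e : K} (he : e ^ 2 = 1)
    (h : P.HasValue (gen K x j) e) (hP : ∃ t, P.ring.IsUniformizer t) :
    P.ring.HasOrd ((gen K x j ^ 2 + 1) / (2 * gen K x j)) 0 := by
  obtain ⟨t, ht⟩ := hP
  have he0 : e ≠ 0 := by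
    rintro rfl
    simp at he
  refine hasOrd_radicand_of_unit h2 (h.valuation_eq_one he0) (ht.hasOrd_zero ?_)
  rw [← P.valuation_two h2]
  refine Valuation.map_eq_of_sub_lt _ ?_
  rw [P.valuation_two h2]
  have := hasValue_iff.1 h.sq
  rw [he, map_one] at this
  convert this using 2
  ring

include hx h2 in
-- The order doubles at each step: `(x_{j+1} - e) * (x_{j+1} + e) = (x_j - 1) ^ 2 / (2 * x_j)`,
-- where `x_{j+1} + e` and `2 * x_j` are units and the step is unramified. Below the top level the
-- residue is always 1, so the induction must vary `e`.
theorem hasOrd_gen_sub {e : K} (he : e ^ 2 = 1) (h : P.HasValue (gen K x j) e) :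
    P.ring.HasOrd (gen K x j - algebraMap K _ e) (2 ^ j) := by
  induction j generalizing e with
  | zero => simpa using hasOrd_gen_zero_sub hx h2 h
  | succ j ih =>
    obtain ⟨P', hP'⟩ := exists_liesOver_step hx h2 P
    have h1 : P'.HasValue (gen K x j) 1 :=
      hP'.hasValue_iff.1 (hasValue_one_of_succ hx h2 le_rfl he h)
    have ho := ih (one_pow 2) h1
    have hs := isSqrtExtension_step hx h2 j
    have hr := hasOrd_radicand_of_hasValue h2 (one_pow 2) h1 (exists_isUniformizer hx h2 P')
    have ho := hs.hasOrd_map hP' (P'.valuation_two h2) (n := 0) (by simpa using hr) ho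
    have he0 : e ≠ 0 := by
      rintro rfl
      simp at he
    obtain ⟨t, ht⟩ := exists_isUniformizer hx h2 P
    have hu := ht.hasOrd_zero (valuation_add_of_hasValue h2 he0 h)
    have hv : P.ring.HasOrd (2 * elt K x j.le_succ) 0 :=
      ht.hasOrd_zero (by
        rw [map_mul, P.valuation_two h2, one_mul]
        exact (hasValue_one_of_succ hx h2 le_rfl he h).valuation_eq_one one_ne_zero)
    have hfin := ((ho.pow 2).div hv).div hu
    have hne : gen K x (j + 1) + algebraMap K _ e ≠ 0 := by
      have := elt_sub_ne_zero hx h2 (le_refl (j + 1)) (-e)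
      rwa [map_neg, sub_neg_eq_add] at this
    have hsq := sq_sub_eq (P.two_ne_zero_of h2) (elt_sq hx (le_refl (j + 1)))
      (elt_ne_zero hx h2 _) (one_pow 2)
    have e1 : algebraMap K (level K x (j + 1)) e ^ 2 = 1 := by rw [← map_pow, he, map_one]
    convert hfin using 1
    · rw [eq_div_iff hne]
      calc _ = gen K x (j + 1) ^ 2 - 1 := by linear_combination -e1
        _ = _ := hsq
        _ = _ := by
          congr 2
          exact (map_sub (step K x j) _ _).symm ▸ by rw [map_one, map_one]; rfl
    · push_cast
      ring

section NegOne

variable {r : ℕ}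

include hx h2 in
theorem hasOrd_gen_add_one {P : Place K (level K x r)} (h : P.HasValue (gen K x r) (-1)) :
    P.ring.HasOrd (gen K x r + 1) (2 ^ r) := by
  have := hasOrd_gen_sub hx h2 (by norm_num) h
  rwa [map_neg, map_one, sub_neg_eq_add] at this

include hx h2 in
-- By `x_{r+1} ^ 2 + 1 = (x_r + 1) ^ 2 / (2 * x_r)` in an unramified step.
theorem hasOrd_gen_sq_add_one {P : Place K (level K x (r + 1))}
    (h : P.HasValue (elt K x r.le_succ) (-1)) :
    P.ring.HasOrd (gen K x (r + 1) ^ 2 + 1) (2 ^ (r + 1)) := by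
  obtain ⟨P', hP'⟩ := exists_liesOver_step hx h2 P
  have h1 : P'.HasValue (gen K x r) (-1) := hP'.hasValue_iff.1 h
  have hs := isSqrtExtension_step hx h2 r
  have hr := hasOrd_radicand_of_hasValue h2 (by norm_num) h1 (exists_isUniformizer hx h2 P')
  have ho := hs.hasOrd_map hP' (P'.valuation_two h2) (n := 0) (by simpa using hr)
    (hasOrd_gen_add_one hx h2 h1)
  obtain ⟨t, ht⟩ := exists_isUniformizer hx h2 P
  have hv : P.ring.HasOrd (2 * elt K x r.le_succ) 0 :=
    ht.hasOrd_zero (by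
      rw [map_mul, P.valuation_two h2, one_mul]
      exact h.valuation_eq_one (neg_ne_zero.2 one_ne_zero))
  have hsq := sq_sub_eq (P.two_ne_zero_of h2) (elt_sq hx (le_refl (r + 1)))
    (elt_ne_zero hx h2 _) (e := -1) (by norm_num)
  rw [sub_neg_eq_add, sub_neg_eq_add] at hsq
  convert (ho.pow 2).div hv using 1
  · exact hsq.trans (by rw [map_add, map_one]; rfl)
  · push_cast
    ring

include hx h2 in
theorem valuation_gen_eq_one_of_hasValue {P : Place K (level K x (r + 1))}
    (h : P.HasValue (elt K x r.le_succ) (-1)) : P.ring.valuation (gen K x (r + 1)) = 1 := by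
  refine P.valuation_eq_one_of_sq_sub (e := -1) (by rw [Valuation.map_neg, map_one]) ?_
  rw [sub_neg_eq_add]
  exact (hasOrd_gen_sq_add_one hx h2 h).valuation_lt_one_iff.2 (by positivity)

include hx h2 in
-- Otherwise `x_{r+1} ^ 2` would have both residues 1 and `-1`.
theorem valuation_one_add_gen_eq_one_of_hasValue {P : Place K (level K x (r + 1))}
    (h : P.HasValue (elt K x r.le_succ) (-1)) : P.ring.valuation (1 + gen K x (r + 1)) = 1 := by
  have hv := valuation_gen_eq_one_of_hasValue hx h2 h
  refine le_antisymm (Valuation.map_add_le _ (map_one _).le hv.le) (not_lt.1 fun hlt => ?_)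
  have h1 : P.HasValue (gen K x (r + 1) ^ 2) ((-1) ^ 2) := HasValue.sq (by
    rwa [hasValue_iff, map_neg, map_one, sub_neg_eq_add, add_comm (gen K x (r + 1))])
  have h3 : P.HasValue (gen K x (r + 1) ^ 2) (-1) := by
    rw [hasValue_iff, map_neg, map_one, sub_neg_eq_add]
    exact (hasOrd_gen_sq_add_one hx h2 h).valuation_lt_one_iff.2 (by positivity)
  have := h1.unique h3
  exact h2 (by linear_combination this)

include hx h2 in
theorem hasOrd_gen_add_two {P : Place K (level K x (r + 2))}
    (h : P.HasValue (elt K x (show r ≤ r + 2 by omega)) (-1)) :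
    P.ring.HasOrd (gen K x (r + 2)) (2 ^ r) := by
  obtain ⟨P', hP'⟩ := exists_liesOver_step hx h2 P
  have h1 : P'.HasValue (elt K x r.le_succ) (-1) := hP'.hasValue_iff.1 h
  have hr := hasOrd_radicand_of_unit h2 (valuation_gen_eq_one_of_hasValue hx h2 h1)
    (hasOrd_gen_sq_add_one hx h2 h1)
  rw [pow_succ' (2 : ℤ)] at hr
  exact (isSqrtExtension_step hx h2 _).hasOrd_of_even hP' (P'.valuation_two h2) hr

include hx h2 in
-- Truncated subtraction expresses that the pole order, once it reaches 1, stays there.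
theorem hasOrd_gen_add_three (m : ℕ) {P : Place K (level K x (r + 3 + m))}
    (h : P.HasValue (elt K x (show r ≤ r + 3 + m by omega)) (-1)) :
    P.ring.HasOrd (gen K x (r + 3 + m)) (-2 ^ (r - 1 - m)) := by
  induction m with
  | zero =>
    obtain ⟨P', hP'⟩ := exists_liesOver_step hx h2 P
    exact hasOrd_gen_succ_of_pow hx h2 hP'
      (Or.inl (hasOrd_gen_add_two hx h2 (hP'.hasValue_iff.1 h)))
  | succ m ih =>
    obtain ⟨P', hP'⟩ := exists_liesOver_step hx h2 P
    exact hasOrd_gen_succ_of_pow hx h2 hP' (Or.inr (ih (hP'.hasValue_iff.1 h)))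

end NegOne

end Orders

/-! ### Uniqueness and finiteness of the places. -/

section Uniqueness

variable (hx : IsGenerating K x) (h2 : (2 : K) ≠ 0) {j : ℕ}

include hx h2 in
theorem eq_of_liesOver_of_odd {P : Place K (level K x j)} {Q₁ Q₂ : Place K (level K x (j + 1))}
    (h₁ : LiesOver (step K x j) Q₁ P) (h₂ : LiesOver (step K x j) Q₂ P) {n : ℤ}
    (h : P.ring.HasOrd ((gen K x j ^ 2 + 1) / (2 * gen K x j)) n) (hn : Odd n) : Q₁ = Q₂ := by
  obtain ⟨k, rfl⟩ := hn
  exact ext_ring ((isSqrtExtension_step hx h2 j).eq_of_odd h₁ h₂ h)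

include hx h2 in
theorem placesInf_subsingleton {P Q : Place K (level K x j)} (hP : P.IsPole (elt K x j.zero_le))
    (hQ : Q.IsPole (elt K x j.zero_le)) : P = Q := by
  induction j with
  | zero => exact eq_of_isPole exists_aeval_div hP hQ
  | succ j ih =>
    obtain ⟨P', hP'⟩ := exists_liesOver_step hx h2 P
    obtain ⟨Q', hQ'⟩ := exists_liesOver_step hx h2 Q
    have h : P'.IsPole (elt K x j.zero_le) := hP'.isPole_iff.1 hP
    obtain rfl := ih h (hQ'.isPole_iff.1 hQ)
    exact eq_of_liesOver_of_odd hx h2 hP' hQ'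
      (hasOrd_radicand h2 one_pos (Or.inr (hasOrd_gen_of_isPole hx h2 h))) (by decide)

include hx h2 in
-- Every step ramifies: the radicand has order `-1` throughout for `c = 0`, and order 1 and then
-- `-1` for `c ^ 2 = -1`.
theorem placesAt_subsingleton {c : K} (hc : c = 0 ∨ c ^ 2 = -1) {P Q : Place K (level K x j)}
    (hP : P.HasValue (elt K x j.zero_le) c) (hQ : Q.HasValue (elt K x j.zero_le) c) : P = Q := by
  induction j with
  | zero => exact eq_of_hasValue (transcendental_elt hx h2 le_rfl) exists_aeval_div hP hQ
  | succ j ih =>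
    obtain ⟨P', hP'⟩ := exists_liesOver_step hx h2 P
    obtain ⟨Q', hQ'⟩ := exists_liesOver_step hx h2 Q
    have h : P'.HasValue (elt K x j.zero_le) c := hP'.hasValue_iff.1 hP
    obtain rfl := ih h (hQ'.hasValue_iff.1 hQ)
    have key : ∃ n, P'.ring.HasOrd ((gen K x j ^ 2 + 1) / (2 * gen K x j)) n ∧ Odd n := by
      rcases hc with rfl | hc
      · rcases j with _ | j
        · exact ⟨_, hasOrd_radicand h2 one_pos (Or.inl (hasOrd_gen_zero hx h2 h)), by decide⟩
        · exact ⟨_, hasOrd_radicand h2 one_pos (Or.inr (hasOrd_gen_of_hasValue_zero hx h2 h)),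
            by decide⟩
      · rcases j with _ | _ | j
        · exact ⟨_, hasOrd_radicand_zero hx h2 hc h, by decide⟩
        · exact ⟨_, hasOrd_radicand h2 one_pos (Or.inl (hasOrd_gen_one hx h2 hc h)), by decide⟩
        · exact ⟨_, hasOrd_radicand h2 one_pos
            (Or.inr (hasOrd_gen_of_sq_eq_neg_one hx h2 hc h)), by decide⟩
    obtain ⟨n, hn, hodd⟩ := key
    exact eq_of_liesOver_of_odd hx h2 hP' hQ' hn hodd

include hx h2 in
-- Below lies the unique place with `x_j = 1`; over it the residue `e` of `x_{j+1}` determines the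
-- valuation ring.
theorem eq_of_hasValue_gen {e : K} (he : e ^ 2 = 1) {P Q : Place K (level K x j)}
    (hP : P.HasValue (gen K x j) e) (hQ : Q.HasValue (gen K x j) e) : P = Q := by
  induction j generalizing e with
  | zero => exact eq_of_hasValue (transcendental_elt hx h2 le_rfl) exists_aeval_div hP hQ
  | succ j ih =>
    obtain ⟨P', hP'⟩ := exists_liesOver_step hx h2 P
    obtain ⟨Q', hQ'⟩ := exists_liesOver_step hx h2 Q
    have h : P'.HasValue (gen K x j) 1 :=
      hP'.hasValue_iff.1 (hasValue_one_of_succ hx h2 le_rfl he hP)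
    obtain rfl := ih (one_pow 2) h (hQ'.hasValue_iff.1 (hasValue_one_of_succ hx h2 le_rfl he hQ))
    have hr := hasOrd_radicand_of_hasValue h2 (one_pow 2) h (exists_isUniformizer hx h2 P')
    exact ext_ring ((isSqrtExtension_step hx h2 j).eq_of_residue hP' hQ' (P'.valuation_two h2)
      hr.valuation_eq_one (c := algebraMap K _ e) hP hQ)

include hx h2 in
theorem finite_setOf_hasValue {r : ℕ} (h : r ≤ j) :
    {P : Place K (level K x j) | P.HasValue (elt K x h) (-1)}.Finite := by
  induction j, h using Nat.le_induction with
  | base =>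
    exact Set.Subsingleton.finite fun P hP Q hQ =>
      eq_of_hasValue_gen hx h2 (e := -1) (by norm_num) hP hQ
  | succ j h ih =>
    refine (ih.biUnion (t := fun P => {Q | LiesOver (step K x j) Q P}) fun P _ => ?_).subset ?_
    · have hs := isSqrtExtension_step hx h2 j
      obtain ⟨t, ht⟩ := exists_isUniformizer hx h2 P
      have h0 : (gen K x j ^ 2 + 1) / (2 * gen K x j) ≠ 0 := by
        intro h
        have := hs.sq
        rw [h, map_zero, sq_eq_zero_iff] at this
        exact elt_ne_zero hx h2 le_rfl this
      obtain ⟨n, hn⟩ := ht.exists_hasOrd h0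
      exact (hs.finite_setOf_comap_eq (P.valuation_two h2) hn).preimage
        ring_injective.injOn
    · intro Q hQ
      obtain ⟨P, hP⟩ := exists_liesOver_step hx h2 Q
      exact Set.mem_biUnion (hP.hasValue_iff.1 hQ) hP

end Uniqueness

end FunctionTower

open scoped Classical in
theorem PlaceDivisor.sumOf_apply {K L : Type*} [Field K] [Field L] [Algebra K L]
    {S : Set (Place K L)} (hS : S.Finite) (P : Place K L) :
    PlaceDivisor.sumOf S P = if P ∈ S then 1 else 0 := by
  rw [PlaceDivisor.sumOf, finsum_mem_eq_finite_toFinset_sum _ hS, Finsupp.finsetSum_apply]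
  simp [Finsupp.single_apply]

/-! ### The index of a place, and orders in terms of it. -/

namespace FunctionTower

open Place ValuationSubring

variable {K F : Type*} [Field K] [Field F] [Algebra K F] {x : ℕ → F}

/-- The place `P` of `T_j` occurs in the divisor `D_r^j`. -/
def OfIndex (i : K) {j : ℕ} (P : Place K (level K x j)) (r : ℤ) : Prop :=
  (r = -2 ∧ P.HasValue (elt K x j.zero_le) (0 : K)) ∨
  (r = -1 ∧ (P.HasValue (elt K x j.zero_le) i ∨ P.HasValue (elt K x j.zero_le) (-i))) ∨
  ∃ n, ∃ h : n ≤ j, r = (n : ℕ) ∧ P.HasValue (elt K x h) (-1)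

section

variable (hx : IsGenerating K x) (h2 : (2 : K) ≠ 0) {i : K} (hi : i ^ 2 = -1) {j : ℕ}
  {P : Place K (level K x j)} {r s : ℤ}

theorem OfIndex.le (h : OfIndex i P r) : r ≤ j := by
  rcases h with ⟨rfl, -⟩ | ⟨rfl, -⟩ | ⟨n, hn, rfl, -⟩ <;> omega

theorem OfIndex.neg_two_le (h : OfIndex i P r) : -2 ≤ r := by
  rcases h with ⟨rfl, -⟩ | ⟨rfl, -⟩ | ⟨n, hn, rfl, -⟩ <;> omega

include hx h2 hi in
/-- The value of `x 0 ^ 2` at a place of index `r`. -/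
theorem OfIndex.hasValue_sq (h : OfIndex i P r) :
    P.HasValue (elt K x j.zero_le ^ 2) (if r = -2 then 0 else if r = -1 then -1 else 1 : K) := by
  rcases h with ⟨rfl, h⟩ | ⟨rfl, h⟩ | ⟨n, hn, rfl, h⟩
  · simpa using h.sq
  · rw [if_neg (by decide), if_pos rfl, ← hi]
    rcases h with h | h
    · exact h.sq
    · simpa only [neg_sq] using h.sq
  · rw [if_neg (by omega), if_neg (by omega)]
    rcases n with _ | n
    · simpa using h.sq
    · simpa using (hasValue_one_of_lt hx h2 hn n.succ_pos (by norm_num) h).sq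

include hx h2 in
theorem not_lt_of_hasValue_neg_one {m n : ℕ} (hm : m ≤ j) (hn : n ≤ j)
    (h : P.HasValue (elt K x hm) (-1)) (h' : P.HasValue (elt K x hn) (-1)) : ¬m < n := fun hlt =>
  h2 (by
    have := h.unique (hasValue_one_of_lt hx h2 hn hlt (e := -1) (by norm_num) h')
    linear_combination -this)

include hx h2 hi in
-- The residue of `x_0 ^ 2`, which is 0, `-1` or 1, separates the indices `-2`, `-1` and the
-- nonnegative ones. Two of the latter cannot differ, as `x_n = -1` forces `x_m = 1` for `m < n`.
theorem OfIndex.unique (h : OfIndex i P r) (h' : OfIndex i P s) : r = s := by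
  have hv := (h.hasValue_sq hx h2 hi).unique (h'.hasValue_sq hx h2 hi)
  have h11 : (1 : K) ≠ -1 := fun h => h2 (by linear_combination h)
  rcases h with ⟨rfl, h⟩ | ⟨rfl, h⟩ | ⟨n, hn, rfl, h⟩ <;>
    rcases h' with ⟨rfl, h'⟩ | ⟨rfl, h'⟩ | ⟨m, hm, rfl, h'⟩
  · rfl
  · simp at hv
  · rw [if_pos rfl, if_neg (by omega), if_neg (by omega)] at hv
    exact absurd hv.symm one_ne_zero
  · simp at hv
  · rfl
  · rw [if_neg (by decide), if_pos rfl, if_neg (by omega), if_neg (by omega)] at hv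
    exact absurd hv.symm h11
  · rw [if_pos rfl, if_neg (by omega), if_neg (by omega)] at hv
    exact absurd hv one_ne_zero
  · rw [if_neg (by omega), if_neg (by omega), if_neg (by decide), if_pos rfl] at hv
    exact absurd hv h11
  · have h₁ := not_lt_of_hasValue_neg_one hx h2 hn hm h h'
    have h₂ := not_lt_of_hasValue_neg_one hx h2 hm hn h' h
    omega

include hx h2 hi in
theorem OfIndex.not_isPole (h : OfIndex i P r) : ¬P.IsPole (elt K x j.zero_le) := fun hp => by
  have := (h.hasValue_sq hx h2 hi).valuation_le_one
  rw [map_pow, pow_le_one_iff_of_nonneg zero_le two_ne_zero] at this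
  exact absurd (isPole_iff.1 hp) (not_lt.2 this)

include hx h2 in
theorem placesInf_finite : (placesInf K x j).Finite :=
  Set.Subsingleton.finite fun _ hP _ hQ => placesInf_subsingleton hx h2
    ((mem_placesInf hx h2).1 hP) ((mem_placesInf hx h2).1 hQ)

include hx h2 in
theorem placesAt_finite {c : K} (hc : c = 0 ∨ c ^ 2 = -1) : (placesAt x j c).Finite :=
  Set.Subsingleton.finite fun _ hP _ hQ => placesAt_subsingleton hx h2 hc
    ((mem_placesAt hx h2).1 hP) ((mem_placesAt hx h2).1 hQ)

include hx h2 in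
theorem placesNegOne_finite : (placesNegOne K x j).Finite :=
  finite_setOf_hasValue hx h2 le_rfl

include hx h2 in
theorem placesAbove_placesNegOne_finite {r : ℕ} (h : r ≤ j) :
    (placesAbove x h (placesNegOne K x r)).Finite := by
  refine (finite_setOf_hasValue hx h2 h).subset fun Q hQ => ?_
  exact (mem_placesAbove_placesNegOne hx h2 h).1 hQ

open scoped Classical in
include hx h2 in
theorem divInf_apply (P : Place K (level K x j)) :
    divInf K x j P = if P.IsPole (elt K x j.zero_le) then 1 else 0 := by
  rw [divInf, PlaceDivisor.sumOf_apply (placesInf_finite hx h2)]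
  simp only [mem_placesInf hx h2]

open scoped Classical in
include hx h2 in
theorem divAt_apply {c : K} (hc : c = 0 ∨ c ^ 2 = -1) (P : Place K (level K x j)) :
    divAt x j c P = if P.HasValue (elt K x j.zero_le) c then 1 else 0 := by
  rw [divAt, PlaceDivisor.sumOf_apply (placesAt_finite hx h2 hc)]
  simp only [mem_placesAt hx h2]

open scoped Classical in
include hx h2 in
theorem divNegOne_apply (P : Place K (level K x j)) :
    divNegOne K x j P = if P.HasValue (gen K x j) (-1) then 1 else 0 := by
  rw [divNegOne, PlaceDivisor.sumOf_apply (placesNegOne_finite hx h2)]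
  rfl

open scoped Classical in
include hx h2 hi in
theorem divD_apply (P : Place K (level K x j)) (r : ℤ) :
    divD x i j r P = if OfIndex i P r then 1 else 0 := by
  have hi' : (-i) ^ 2 = -1 := by rw [neg_sq, hi]
  -- Otherwise the two summands of `D_{-1}` would coincide and give coefficient 2.
  have hii : i ≠ -i := fun h => by
    have h4 : 2 * i = 0 := by linear_combination h
    rcases mul_eq_zero.1 h4 with h | h
    · exact h2 h
    · simp [h] at hi
  rw [divD]
  by_cases h₁ : r = -2
  · subst h₁
    rw [if_pos rfl, divAt_apply hx h2 (Or.inl rfl)]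
    refine if_congr ⟨fun h => Or.inl ⟨rfl, h⟩, ?_⟩ rfl rfl
    rintro (⟨-, h⟩ | ⟨h, -⟩ | ⟨n, -, h, -⟩)
    exacts [h, by omega, by omega]
  rw [if_neg h₁]
  by_cases h₂ : r = -1
  · subst h₂
    rw [if_pos rfl, Finsupp.add_apply, divAt_apply hx h2 (Or.inr hi),
      divAt_apply hx h2 (Or.inr hi')]
    have hiff : OfIndex i P (-1) ↔
        (P.HasValue (elt K x j.zero_le) i ∨ P.HasValue (elt K x j.zero_le) (-i)) := by
      refine ⟨?_, fun h => Or.inr (Or.inl ⟨rfl, h⟩)⟩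
      rintro (⟨h, -⟩ | ⟨-, h⟩ | ⟨n, -, h, -⟩)
      exacts [by omega, h, by omega]
    rw [if_congr hiff rfl rfl]
    by_cases h : P.HasValue (elt K x j.zero_le) i
    · have h' : ¬P.HasValue (elt K x j.zero_le) (-i) := fun h' => hii (h.unique h')
      simp [h, h']
    · simp [h]
  rw [if_neg h₂]
  by_cases h₃ : 0 ≤ r ∧ r.toNat ≤ j
  · rw [dif_pos h₃, PlaceDivisor.sumOf_apply (placesAbove_placesNegOne_finite hx h2 h₃.2)]
    refine if_congr ((mem_placesAbove_placesNegOne hx h2 h₃.2).trans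
      ⟨fun h => Or.inr (Or.inr ⟨r.toNat, h₃.2, by omega, h⟩), ?_⟩) rfl rfl
    rintro (⟨h, -⟩ | ⟨h, -⟩ | ⟨n, hn, rfl, h⟩)
    exacts [absurd h h₁, absurd h h₂, h]
  · rw [dif_neg h₃, if_neg, Finsupp.zero_apply]
    rintro (⟨h, -⟩ | ⟨h, -⟩ | ⟨n, hn, rfl, h⟩)
    exacts [h₁ h, h₂ h, h₃ ⟨by omega, by omega⟩]

/-- The order of `x j` at a place of index `r`. -/
def ordGen (j : ℕ) (r : ℤ) : ℤ :=
  if r + 3 ≤ j then -2 ^ (2 * r - j + 2).toNat else if r + 2 = j then 2 ^ (j - 2) else 0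

/-- The order of `1 + x j` at a place of index `r`. -/
def ordOneAddGen (j : ℕ) (r : ℤ) : ℤ :=
  if r + 3 ≤ j then -2 ^ (2 * r - j + 2).toNat else if r = j then 2 ^ j else 0

include hx h2 hi in
theorem OfIndex.hasOrd_gen (h : OfIndex i P r) : P.ring.HasOrd (gen K x j) (ordGen j r) := by
  rcases h with ⟨rfl, h⟩ | ⟨rfl, h⟩ | ⟨n, hn, rfl, h⟩
  -- At level 0 the second branch of `ordGen` applies, with exponent `0 - 2` truncated to 0;
  -- likewise `1 - 2` for index `-1` at level 1.
  · rcases j with _ | j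
    · exact hasOrd_gen_zero hx h2 h
    rw [ordGen, if_pos (by omega), show (2 * (-2 : ℤ) - (j + 1 : ℕ) + 2).toNat = 0 by omega]
    exact hasOrd_gen_of_hasValue_zero hx h2 h
  · obtain ⟨c, hc, h⟩ : ∃ c : K, c ^ 2 = -1 ∧ P.HasValue (elt K x j.zero_le) c := by
      rcases h with h | h
      exacts [⟨i, hi, h⟩, ⟨-i, by rw [neg_sq, hi], h⟩]
    rcases j with _ | _ | j
    · obtain ⟨t, ht⟩ := exists_isUniformizer hx h2 P
      refine ht.hasOrd_zero (h.valuation_eq_one ?_)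
      rintro rfl
      simp at hc
    · exact hasOrd_gen_one hx h2 hc h
    rw [ordGen, if_pos (by omega), show (2 * (-1 : ℤ) - (j + 2 : ℕ) + 2).toNat = 0 by omega]
    exact hasOrd_gen_of_sq_eq_neg_one hx h2 hc h
  · obtain ⟨m, rfl | rfl | rfl | ⟨m, rfl⟩⟩ : ∃ m, j = n ∨ j = n + 1 ∨ j = n + 2 ∨
        ∃ m, j = n + 3 + m := by
      refine ⟨0, ?_⟩
      by_cases h3 : n + 3 ≤ j
      · exact Or.inr (Or.inr (Or.inr (Nat.exists_eq_add_of_le h3)))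
      · omega
    · obtain ⟨t, ht⟩ := exists_isUniformizer hx h2 P
      rw [ordGen, if_neg (by omega), if_neg (by omega)]
      exact ht.hasOrd_zero (h.valuation_eq_one (neg_ne_zero.2 one_ne_zero))
    · obtain ⟨t, ht⟩ := exists_isUniformizer hx h2 P
      rw [ordGen, if_neg (by omega), if_neg (by omega)]
      exact ht.hasOrd_zero (valuation_gen_eq_one_of_hasValue hx h2 h)
    · rw [ordGen, if_neg (by omega), if_pos (by omega)]
      exact hasOrd_gen_add_two hx h2 h
    · rw [ordGen, if_pos (by omega),
        show (2 * (n : ℤ) - (n + 3 + m : ℕ) + 2).toNat = n - 1 - m by omega]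
      exact hasOrd_gen_add_three hx h2 m h

theorem hasOrd_one_add_of_neg {n : ℤ} (hn : n < 0) (h : P.ring.HasOrd (gen K x j) n) :
    P.ring.HasOrd (1 + gen K x j) n := by
  rw [add_comm]
  exact h.congr (P.valuation_add_one_of_one_lt (h.one_lt_valuation_iff.2 hn))

include hx h2 hi in
theorem OfIndex.hasOrd_one_add_gen (h : OfIndex i P r) :
    P.ring.HasOrd (1 + gen K x j) (ordOneAddGen j r) := by
  have ho := h.hasOrd_gen hx h2 hi
  obtain ⟨t, ht⟩ := exists_isUniformizer hx h2 P
  by_cases h3 : r + 3 ≤ j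
  · rw [ordGen, if_pos h3] at ho
    rw [ordOneAddGen, if_pos h3]
    exact hasOrd_one_add_of_neg (by simp) ho
  rw [ordOneAddGen, if_neg h3]
  by_cases h2j : r + 2 = j
  · rw [ordGen, if_neg h3, if_pos h2j] at ho
    rw [if_neg (by omega), add_comm]
    exact ht.hasOrd_zero (P.valuation_add_one_of_lt_one (ho.valuation_lt_one_iff.2 (by positivity)))
  have hle := h.le
  rcases h with ⟨rfl, h⟩ | ⟨rfl, h⟩ | ⟨n, hn, rfl, h⟩
  · omega
  · obtain rfl : j = 0 := by omega
    obtain ⟨c, hc, h⟩ : ∃ c : K, c ^ 2 = -1 ∧ P.HasValue (gen K x 0) c := by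
      rcases h with h | h
      exacts [⟨i, hi, h⟩, ⟨-i, by rw [neg_sq, hi], h⟩]
    rw [if_neg (by omega)]
    refine ht.hasOrd_zero (le_antisymm
      (Valuation.map_add_le _ (map_one _).le h.valuation_le_one) (not_lt.1 fun hlt => ?_))
    have h1 : P.HasValue (gen K x 0) (-1) := by
      rwa [hasValue_iff, map_neg, map_one, sub_neg_eq_add, add_comm]
    have := h.unique h1
    rw [this] at hc
    exact h2 (by linear_combination hc)
  · obtain rfl | rfl : j = n ∨ j = n + 1 := by omega
    · rw [if_pos rfl, add_comm]
      exact hasOrd_gen_add_one hx h2 h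
    · rw [if_neg (by omega)]
      exact ht.hasOrd_zero (valuation_one_add_gen_eq_one_of_hasValue hx h2 h)

include hx h2 hi in
theorem valuation_eq_one_of_forall (hp : ¬P.IsPole (elt K x j.zero_le))
    (hr : ∀ r, ¬OfIndex i P r) :
    P.ring.valuation (gen K x j) = 1 ∧ P.ring.valuation (1 + gen K x j) = 1 := by
  rcases place_cases hx h2 hi P with h | h | h | ⟨r, hrj, h⟩ | h
  · exact absurd h hp
  · exact absurd (Or.inl ⟨rfl, h⟩) (hr (-2))
  · exact absurd (Or.inr (Or.inl ⟨rfl, h⟩)) (hr (-1))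
  · exact absurd (Or.inr (Or.inr ⟨r, hrj, rfl, h⟩)) (hr r)
  · exact h

include hx h2 hi in
theorem isDivisorOf_gen {D : PlaceDivisor K (level K x j)}
    (hpole : ∀ P, P.IsPole (elt K x j.zero_le) → (∀ r, ¬OfIndex i P r) → D P = -1)
    (hindex : ∀ P r, ¬P.IsPole (elt K x j.zero_le) → OfIndex i P r → D P = ordGen j r)
    (hnone : ∀ P, ¬P.IsPole (elt K x j.zero_le) → (∀ r, ¬OfIndex i P r) → D P = 0) :
    D.IsDivisorOf (gen K x j) := by
  intro P
  obtain ⟨t, ht⟩ := exists_isUniformizer hx h2 P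
  rw [hasOrder_iff ⟨t, ht⟩]
  by_cases hp : P.IsPole (elt K x j.zero_le)
  · rw [hpole P hp fun r hr => hr.not_isPole hx h2 hi hp]
    exact hasOrd_gen_of_isPole hx h2 hp
  by_cases hr : ∃ r, OfIndex i P r
  · obtain ⟨r, hr⟩ := hr
    rw [hindex P r hp hr]
    exact hr.hasOrd_gen hx h2 hi
  · push Not at hr
    rw [hnone P hp hr]
    exact ht.hasOrd_zero (valuation_eq_one_of_forall hx h2 hi hp hr).1

include hx h2 hi in
theorem isDivisorOf_one_add_gen {D : PlaceDivisor K (level K x j)}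
    (hpole : ∀ P, P.IsPole (elt K x j.zero_le) → (∀ r, ¬OfIndex i P r) → D P = -1)
    (hindex : ∀ P r, ¬P.IsPole (elt K x j.zero_le) → OfIndex i P r → D P = ordOneAddGen j r)
    (hnone : ∀ P, ¬P.IsPole (elt K x j.zero_le) → (∀ r, ¬OfIndex i P r) → D P = 0) :
    D.IsDivisorOf (1 + gen K x j) := by
  intro P
  obtain ⟨t, ht⟩ := exists_isUniformizer hx h2 P
  rw [hasOrder_iff ⟨t, ht⟩]
  by_cases hp : P.IsPole (elt K x j.zero_le)
  · rw [hpole P hp fun r hr => hr.not_isPole hx h2 hi hp]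
    exact hasOrd_one_add_of_neg (by decide) (hasOrd_gen_of_isPole hx h2 hp)
  by_cases hr : ∃ r, OfIndex i P r
  · obtain ⟨r, hr⟩ := hr
    rw [hindex P r hp hr]
    exact hr.hasOrd_one_add_gen hx h2 hi
  · push Not at hr
    rw [hnone P hp hr]
    exact ht.hasOrd_zero (valuation_eq_one_of_forall hx h2 hi hp hr).2

open scoped Classical in
include hx h2 hi in
theorem OfIndex.divD_apply (h : OfIndex i P r) (s : ℤ) :
    divD x i j s P = if s = r then 1 else 0 := by
  rw [FunctionTower.divD_apply hx h2 hi]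
  exact if_congr ⟨fun h' => h'.unique hx h2 hi h, fun h' => h' ▸ h⟩ rfl rfl

theorem divAt_zero_apply (i : K) (P : Place K (level K x j)) :
    divAt x j (0 : K) P = divD x i j (-2) P := by
  rw [divD, if_pos rfl]

include hx h2 hi in
theorem divNegOne_apply_eq (P : Place K (level K x j)) :
    divNegOne K x j P = divD x i j j P := by
  classical
  rw [divNegOne_apply hx h2, divD_apply hx h2 hi]
  refine if_congr ⟨fun h => Or.inr (Or.inr ⟨j, le_rfl, rfl, h⟩), ?_⟩ rfl rfl
  rintro (⟨h, -⟩ | ⟨h, -⟩ | ⟨n, hn, h, hP⟩)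
  · omega
  · omega
  · obtain rfl : j = n := by omega
    exact hP

include hx h2 hi in
-- The two summation ranges are adjacent and cover `-2, …, j - 3`; on the first `2 * r - j + 2` is
-- negative, so the truncated exponent gives coefficient 1 there too.
theorem poleDivisor_apply_of_ofIndex (hj : 2 ≤ j) (h : OfIndex i P r) :
    poleDivisor x i j P = if r + 3 ≤ j then 2 ^ (2 * r - j + 2).toNat else 0 := by
  classical
  have h₁ := h.neg_two_le
  simp only [poleDivisor, Finsupp.add_apply, Finsupp.finsetSum_apply, Finsupp.smul_apply,
    h.divD_apply hx h2 hi,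
    divInf_apply hx h2, if_neg (h.not_isPole hx h2 hi), smul_eq_mul, mul_ite, mul_one, mul_zero,
    Finset.sum_ite_eq', Finset.mem_Icc]
  by_cases hr : r ≤ ((j : ℤ) - 3) / 2
  · rw [if_pos ⟨h₁, hr⟩, if_neg (by omega), if_pos (by omega),
      show (2 * r - j + 2).toNat = 0 by omega]
    rfl
  · rw [if_neg (by omega)]
    by_cases hr' : r + 3 ≤ j
    · rw [if_pos (by omega), if_pos hr']
      simp
    · rw [if_neg (by omega), if_neg hr']
      simp

include hx h2 hi in
theorem poleDivisor_apply_of_forall (h : ∀ r, ¬OfIndex i P r) :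
    poleDivisor x i j P = divInf K x j P := by
  classical
  simp [poleDivisor, divD_apply hx h2 hi, h]

end

end FunctionTower

theorem two_ne_zero_of_natCard {K : Type*} [Field K] {p : ℕ} (hp : p.Prime) (hp2 : p ≠ 2)
    (hK : Nat.card K = p ^ 2) : (2 : K) ≠ 0 := by
  intro h
  have h1 : addOrderOf (1 : K) ∣ 2 := addOrderOf_dvd_of_nsmul_eq_zero (by simpa using h)
  have h3 : addOrderOf (1 : K) ∣ p ^ 2 := hK ▸ addOrderOf_dvd_natCard (1 : K)
  have hcop : Nat.Coprime 2 (p ^ 2) :=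
    (((Nat.coprime_primes Nat.prime_two hp).2 hp2.symm)).pow_right 2
  have h4 := Nat.eq_one_of_dvd_coprimes hcop h1 h3
  rw [AddMonoid.addOrderOf_eq_one_iff] at h4
  exact one_ne_zero h4

/-! ### Existence of the distinguished places and the principal divisors. -/

namespace FunctionTower

open Place ValuationSubring

variable {K F : Type*} [Field K] [Field F] [Algebra K F] {x : ℕ → F}
  (hx : IsGenerating K x) (h2 : (2 : K) ≠ 0) {i : K} (hi : i ^ 2 = -1)

include hx h2 in
theorem existsUnique_mem_placesInf (j : ℕ) : ∃! Q, Q ∈ placesInf K x j := by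
  obtain ⟨Q, hQ⟩ := exists_isPole (transcendental_elt hx h2 j.zero_le)
  refine ⟨Q, (mem_placesInf hx h2).2 hQ, fun Q' hQ' => ?_⟩
  exact placesInf_subsingleton hx h2 ((mem_placesInf hx h2).1 hQ') hQ

include hx h2 in
theorem existsUnique_mem_placesAt (j : ℕ) {c : K} (hc : c = 0 ∨ c ^ 2 = -1) :
    ∃! Q, Q ∈ placesAt x j c := by
  obtain ⟨Q, hQ⟩ := exists_hasValue (transcendental_elt hx h2 j.zero_le) c
  refine ⟨Q, (mem_placesAt hx h2).2 hQ, fun Q' hQ' => ?_⟩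
  exact placesAt_subsingleton hx h2 hc ((mem_placesAt hx h2).1 hQ') hQ

include hx h2 in
theorem existsUnique_mem_placesNegOne (j : ℕ) : ∃! Q, Q ∈ placesNegOne K x j := by
  obtain ⟨Q, hQ⟩ := exists_hasValue (transcendental_elt hx h2 (le_refl j)) (-1 : K)
  exact ⟨Q, hQ, fun Q' hQ' => eq_of_hasValue_gen hx h2 (by norm_num) hQ' hQ⟩

include hx h2 hi in
theorem isDivisorOf_gen_zero :
    (-divInf K x 0 + divAt x 0 (0 : K)).IsDivisorOf (gen K x 0) := by
  classical
  refine isDivisorOf_gen hx h2 hi (fun P hp hr => ?_) (fun P r hp hr => ?_) fun P hp hr => ?_ <;>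
    simp only [Finsupp.add_apply, Finsupp.neg_apply, divInf_apply hx h2, divAt_zero_apply i, hp]
  · simp [divD_apply hx h2 hi, hr]
  · have := hr.neg_two_le
    have := hr.le
    rw [hr.divD_apply hx h2 hi, ordGen, if_neg (show ¬r + 3 ≤ ((0 : ℕ) : ℤ) by omega)]
    by_cases h : r = -2
    · simp [h]
    · rw [if_neg (Ne.symm h), if_neg (show ¬r + 2 = ((0 : ℕ) : ℤ) by omega)]
      simp
  · simp [divD_apply hx h2 hi, hr]

include hx h2 hi in
theorem isDivisorOf_gen_one :
    (-divInf K x 1 - divAt x 1 (0 : K) + divD x i 1 (-1)).IsDivisorOf (gen K x 1) := by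
  classical
  refine isDivisorOf_gen hx h2 hi (fun P hp hr => ?_) (fun P r hp hr => ?_) fun P hp hr => ?_ <;>
    simp only [Finsupp.add_apply, Finsupp.sub_apply, Finsupp.neg_apply, divInf_apply hx h2,
      divAt_zero_apply i, hp]
  · simp [divD_apply hx h2 hi, hr]
  · have := hr.neg_two_le
    rw [hr.divD_apply hx h2 hi, hr.divD_apply hx h2 hi, ordGen]
    by_cases h : r = -2
    · simp [h]
    by_cases h' : r = -1
    · simp [h']
    · rw [if_neg (Ne.symm h), if_neg (Ne.symm h'), if_neg (show ¬r + 3 ≤ ((1 : ℕ) : ℤ) by omega),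
        if_neg (show ¬r + 2 = ((1 : ℕ) : ℤ) by omega)]
      simp
  · simp [divD_apply hx h2 hi, hr]

include hx h2 hi in
theorem isDivisorOf_gen_of_two_le {j : ℕ} (hj : 2 ≤ j) :
    (-poleDivisor x i j + (2 : ℤ) ^ (j - 2) • divD x i j ((j : ℤ) - 2)).IsDivisorOf
      (gen K x j) := by
  classical
  refine isDivisorOf_gen hx h2 hi (fun P hp hr => ?_) (fun P r hp hr => ?_) fun P hp hr => ?_ <;>
    simp only [Finsupp.add_apply, Finsupp.neg_apply, Finsupp.smul_apply]
  · simp [poleDivisor_apply_of_forall hx h2 hi hr, divInf_apply hx h2, hp, divD_apply hx h2 hi, hr]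
  · rw [poleDivisor_apply_of_ofIndex hx h2 hi hj hr, hr.divD_apply hx h2 hi, ordGen]
    by_cases h : r + 3 ≤ j
    · rw [if_pos h, if_pos h, if_neg (by omega)]
      simp
    · rw [if_neg h, if_neg h]
      by_cases h' : r + 2 = j
      · rw [if_pos h', if_pos (by omega)]
        simp
      · rw [if_neg h', if_neg (by omega)]
        simp
  · simp [poleDivisor_apply_of_forall hx h2 hi hr, divInf_apply hx h2, hp, divD_apply hx h2 hi, hr]

include hx h2 hi in
theorem isDivisorOf_one_add_gen_zero :
    (-divInf K x 0 + divNegOne K x 0).IsDivisorOf (1 + gen K x 0) := by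
  classical
  refine isDivisorOf_one_add_gen hx h2 hi (fun P hp hr => ?_) (fun P r hp hr => ?_)
    fun P hp hr => ?_ <;>
    simp only [Finsupp.add_apply, Finsupp.neg_apply, divInf_apply hx h2,
      divNegOne_apply_eq hx h2 hi, hp]
  · simp [divD_apply hx h2 hi, hr]
  · have := hr.neg_two_le
    rw [hr.divD_apply hx h2 hi, ordOneAddGen, if_neg (show ¬r + 3 ≤ ((0 : ℕ) : ℤ) by omega)]
    simp [eq_comm]
  · simp [divD_apply hx h2 hi, hr]

include hx h2 hi in
theorem isDivisorOf_one_add_gen_one :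
    (-divInf K x 1 - divAt x 1 (0 : K) + (2 : ℤ) • divNegOne K x 1).IsDivisorOf
      (1 + gen K x 1) := by
  classical
  refine isDivisorOf_one_add_gen hx h2 hi (fun P hp hr => ?_) (fun P r hp hr => ?_)
    fun P hp hr => ?_ <;>
    simp only [Finsupp.add_apply, Finsupp.sub_apply, Finsupp.neg_apply, Finsupp.smul_apply,
      divInf_apply hx h2, divAt_zero_apply i, divNegOne_apply_eq hx h2 hi, hp]
  · simp [divD_apply hx h2 hi, hr]
  · have := hr.neg_two_le
    rw [hr.divD_apply hx h2 hi, hr.divD_apply hx h2 hi, ordOneAddGen]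
    by_cases h : r = -2
    · simp [h]
    · rw [if_neg (Ne.symm h), if_neg (show ¬r + 3 ≤ ((1 : ℕ) : ℤ) by omega)]
      simp [eq_comm]
  · simp [divD_apply hx h2 hi, hr]

include hx h2 hi in
theorem isDivisorOf_one_add_gen_of_two_le {j : ℕ} (hj : 2 ≤ j) :
    (-poleDivisor x i j + (2 : ℤ) ^ j • divNegOne K x j).IsDivisorOf (1 + gen K x j) := by
  classical
  refine isDivisorOf_one_add_gen hx h2 hi (fun P hp hr => ?_) (fun P r hp hr => ?_)
    fun P hp hr => ?_ <;>
    simp only [Finsupp.add_apply, Finsupp.neg_apply, Finsupp.smul_apply,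
      divNegOne_apply_eq hx h2 hi]
  · simp [poleDivisor_apply_of_forall hx h2 hi hr, divInf_apply hx h2, hp, divD_apply hx h2 hi, hr]
  · rw [poleDivisor_apply_of_ofIndex hx h2 hi hj hr, hr.divD_apply hx h2 hi, ordOneAddGen]
    by_cases h : r + 3 ≤ j
    · rw [if_pos h, if_pos h, if_neg (by omega)]
      simp
    · rw [if_neg h, if_neg h]
      simp [eq_comm]
  · simp [poleDivisor_apply_of_forall hx h2 hi hr, divInf_apply hx h2, hp, divD_apply hx h2 hi, hr]

include hx h2 in
theorem exists_unique_zero_one_add_gen (j : ℕ) :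
    ∃ P ∈ placesNegOne K x j, P.HasOrder (1 + gen K x j) (2 ^ j) ∧
      ∀ (Q : Place K (level K x j)) (n : ℤ),
        Q.HasOrder (1 + gen K x j) n → 0 < n → Q = P := by
  obtain ⟨P, hP, huniq⟩ := existsUnique_mem_placesNegOne hx h2 j
  refine ⟨P, hP, ?_, fun Q n hQ hn => huniq Q ?_⟩
  · rw [hasOrder_iff (exists_isUniformizer hx h2 P), add_comm]
    exact hasOrd_gen_add_one hx h2 hP
  · rw [hasOrder_iff (exists_isUniformizer hx h2 Q)] at hQ
    change Q.HasValue _ _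
    rw [hasValue_iff, map_neg, map_one, sub_neg_eq_add, add_comm]
    exact hQ.valuation_lt_one_iff.2 hn

end FunctionTower

open FunctionTower PlaceDivisor in
theorem mainTheorem7 (p : ℕ) (hp : p.Prime) (hp2 : p ≠ 2)
    {K : Type*} [Field K] (hK : Nat.card K = p ^ 2) (i : K) (hi : i ^ 2 = -1)
    {F : Type*} [Field F] [Algebra K F] (x : ℕ → F) (hx : IsGenerating K x) :
    -- the places `P_∞^j`, `P_0^j`, `P_i^j`, `P_{-i}^j`, `P_{-1}^j` and the divisors `D_r^j`
    -- are well defined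
    (∀ j, (∃! Q, Q ∈ placesInf K x j) ∧ (∃! Q, Q ∈ placesAt x j (0 : K)) ∧
      (∃! Q, Q ∈ placesAt x j i) ∧ (∃! Q, Q ∈ placesAt x j (-i)) ∧
      (∃! Q, Q ∈ placesNegOne K x j) ∧
      ∀ r, ∀ h : r ≤ j, (placesAbove x h (placesNegOne K x r)).Finite) ∧
    -- the divisor of `x_j`
    IsDivisorOf (-divInf K x 0 + divAt x 0 (0 : K)) (gen K x 0) ∧
    IsDivisorOf (-divInf K x 1 - divAt x 1 (0 : K) + divD x i 1 (-1)) (gen K x 1) ∧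
    (∀ j, 2 ≤ j →
      IsDivisorOf (-poleDivisor x i j + (2 : ℤ) ^ (j - 2) • divD x i j ((j : ℤ) - 2))
        (gen K x j)) ∧
    -- the divisor of `1 + x_j`
    IsDivisorOf (-divInf K x 0 + divNegOne K x 0) (1 + gen K x 0) ∧
    IsDivisorOf (-divInf K x 1 - divAt x 1 (0 : K) + (2 : ℤ) • divNegOne K x 1)
      (1 + gen K x 1) ∧
    (∀ j, 2 ≤ j →
      IsDivisorOf (-poleDivisor x i j + (2 : ℤ) ^ j • divNegOne K x j) (1 + gen K x j)) ∧
    -- `P_{-1}^j` is the only zero of `1 + x_j`, and its order is `2 ^ j`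
    (∀ j, ∃ P ∈ placesNegOne K x j, P.HasOrder (1 + gen K x j) (2 ^ j) ∧
      ∀ (Q : Place K (level K x j)) (n : ℤ),
        Q.HasOrder (1 + gen K x j) n → 0 < n → Q = P) := by
  have h2 := two_ne_zero_of_natCard hp hp2 hK
  have hi' : (-i) ^ 2 = -1 := by rw [neg_sq, hi]
  exact ⟨fun j => ⟨existsUnique_mem_placesInf hx h2 j,
      existsUnique_mem_placesAt hx h2 j (Or.inl rfl),
      existsUnique_mem_placesAt hx h2 j (Or.inr hi),
      existsUnique_mem_placesAt hx h2 j (Or.inr hi'),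
      existsUnique_mem_placesNegOne hx h2 j,
      fun _ h => placesAbove_placesNegOne_finite hx h2 h⟩,
    isDivisorOf_gen_zero hx h2 hi, isDivisorOf_gen_one hx h2 hi,
    fun _ hj => isDivisorOf_gen_of_two_le hx h2 hi hj,
    isDivisorOf_one_add_gen_zero hx h2 hi, isDivisorOf_one_add_gen_one hx h2 hi,
    fun _ hj => isDivisorOf_one_add_gen_of_two_le hx h2 hi hj,
    exists_unique_zero_one_add_gen hx h2⟩
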